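/- **Conventions.** All graphs are finite. A multigraph may have parallel edges and loops; the degree $\deg(v)$ is the number of edge-ends at $v$ (a loop counts twice). A trail in a multigraph is a walk without repeated edges; $t(L)$ is the length (number of edges) of a longest trail of $L$. A multigraph $L$ is *admissible* if (A-1) $t(L)<|E(L)|$, and (A-2) for each vertex $v$ and each edge $e$ incident with $v$ there is a trail of length $t(L)$ that begins $v,e,\dots$ and contains every vertex of $L$. A simple graph $M$ is an *HCTV graph* (homogeneously connected from two vertices) if it is $K_1$, or if it has two vertices $x,y$, called *anchors*, such that each vertex of $M$ is the initial vertex of a hamiltonian path whose other endvertex is $x$ or $y$. *Inflating* a vertex $v$ with $K_n$, $n\ge\deg(v)$, means replacing $v$ by a copy of $K_n$ and attaching the edge-ends at $v$ to distinct vertices of this $K_n$. *Inserting* an HCTV graph $M$ in an edge $e$ means deleting $e$ and joining its two end points to the two anchors of $M$ by a matching if $M\ne K_1$, or both to the vertex of $M$ if $M=K_1$. For a simple graph $G$, the *detour order* $\tau(v)$ of a vertex $v$ is the number of vertices of a longest path with initial vertex $v$, $\tau(G)=\max_v\tau(v)$, and $|V(G)|-\tau(G)$ is the *detour deficiency* of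 $G$. A *CND graph* is a simple graph that is connected, nontraceable (it has no hamiltonian path), and in which all vertices have the same detour order. **Theorem.** 1. Let $L$ be an admissible multigraph, $E(L)=\{e_1,\dots,e_k\}$, and let $M_1,\dots,M_k$ be HCTV graphs, all of the same order $m$. Let $F$ be obtained by first inflating each vertex $v$ of $L$ with a complete graph $K_{n_v}$ for some $n_v\ge\deg(v)$ (which may depend on $v$), and then inserting a copy of $M_i$ in the edge $e_i$ of $L$, $i=1,\dots,k$. Then $F$ is a CND graph. 2. $K_4$ is admissible, and for every $N\ge 18$ a CND graph of order $N$ is obtained in this way from $L=K_4$, by inflating three vertices with $K_3$ and one vertex with $K_{N-15}$ and inserting $K_1$ in every edge. 3. Let $C_2\times K_2$ be the cubic multigraph with vertices $a_0,a_1,b_0,b_1$, two parallel edges $a_0b_0$, two parallel edges $a_1b_1$, one edge $a_0a_1$ and one edge $b_0b_1$. It is admissible. If $L$ is $K_4$ or $C_2\times K_2$ (both are cubic), every vertex is inflated with $K_3$ and $K_1$ is inserted in every edge, then one gets a CND graph of order $18$, size $24$ and detour deficiency $1$; the graph obtained from $K_4$ and the graph obtained from $C_2\times K_2$ are not isomorphic.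 -/

import Mathlib

open scoped Graph

namespace Graph

universe u v

variable {α : Type u} {β : Type v}

/-- The degree of a vertex of a (finite) multigraph: the number of edge-ends at the vertex,
so that a loop counts twice. -/
noncomputable def degree (L : Graph α β) (x : α) : ℕ :=
  (L.incidenceSet x).ncard + (L.loopSet x).ncard

/-- `L.IsWalkFrom x p`: starting at the vertex `x`, the list `p = [(e₁, x₁), …, (eₖ, xₖ)]`
describes a walk `x, e₁, x₁, e₂, …, eₖ, xₖ` in `L`. -/
def IsWalkFrom (L : Graph α β) : α → List (β × α) → Prop
  | x, [] => x ∈ V(L)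
  | x, (e, y) :: p => L.IsLink e x y ∧ L.IsWalkFrom y p

/-- A trail is a walk without repeated edges. Its length is `p.length`. -/
def IsTrailFrom (L : Graph α β) (x : α) (p : List (β × α)) : Prop :=
  L.IsWalkFrom x p ∧ (p.map Prod.fst).Nodup

/-- The length of a longest trail of a (finite) multigraph. -/
noncomputable def maxTrailLength (L : Graph α β) : ℕ :=
  sSup {k | ∃ (x : α) (p : List (β × α)), L.IsTrailFrom x p ∧ p.length = k}

/-- Admissible multigraphs: no trail uses all edges, and for every vertex `x` and every edge `e`
incident with `x` some longest trail starts `x, e, …` and visits every vertex. -/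
structure IsAdmissible (L : Graph α β) : Prop where
  maxTrailLength_lt : L.maxTrailLength < E(L).ncard
  exists_trail : ∀ (x : α) (e : β), L.Inc e x →
    ∃ (y : α) (q : List (β × α)), L.IsTrailFrom x ((e, y) :: q) ∧
      ((e, y) :: q).length = L.maxTrailLength ∧
      ∀ z ∈ V(L), z ∈ x :: ((e, y) :: q).map Prod.snd

/-- The cubic multigraph `C₂ × K₂`: the vertices are the pairs `(i, j)`; for each `j` there are two
parallel edges between `(false, j)` and `(true, j)`, and for each `i` there is one edge between
`(i, false)` and `(i, true)`. -/
def c2BoxK2 : Graph (Bool × Bool) ((Bool × Bool) ⊕ Bool) where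
  vertexSet := Set.univ
  IsLink e x y := match e with
    | .inl (j, _) => s(x, y) = s((false, j), (true, j))
    | .inr i => s(x, y) = s((i, false), (i, true))
  isLink_symm := by
    rintro (⟨j, k⟩ | i) - <;> constructor <;> intro x y h <;> simpa [Sym2.eq_swap] using h
  eq_or_eq_of_isLink_of_isLink := by
    rintro (⟨j, k⟩ | i) x y z w h h' <;>
    · have := h.trans h'.symm
      simp only [Sym2.eq_iff] at this
      tauto
  left_mem_of_isLink := by simp

end Graph

namespace SimpleGraph

universe u v

variable {V : Type u}

open Classical in
/-- A graph is traceable if it has a hamiltonian path. -/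
def IsTraceable (G : SimpleGraph V) : Prop :=
  ∃ (x y : V) (p : G.Walk x y), p.IsHamiltonian

/-- The detour order of a vertex `x` of a (finite) graph: the number of vertices of a longest path
with initial vertex `x`. -/
noncomputable def vertexDetourOrder (G : SimpleGraph V) (x : V) : ℕ :=
  sSup {k | ∃ (y : V) (p : G.Walk x y), p.IsPath ∧ p.support.length = k}

/-- The detour order of a (finite) graph: the number of vertices of a longest path. -/
noncomputable def detourOrder (G : SimpleGraph V) : ℕ :=
  sSup {k | ∃ (x y : V) (p : G.Walk x y), p.IsPath ∧ p.support.length = k}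

/-- Connected, nontraceable, detour graphs; a detour graph is one in which all vertices have the
same detour order. -/
structure IsCND (G : SimpleGraph V) : Prop where
  connected : G.Connected
  not_isTraceable : ¬ G.IsTraceable
  detour : ∀ x y : V, G.vertexDetourOrder x = G.vertexDetourOrder y

open Classical in
/-- `x, y` are anchors of `M`: two vertices such that every vertex of `M` is the initial vertex of
a hamiltonian path whose other endvertex is `x` or `y`. -/
def IsAnchorPair (M : SimpleGraph V) (x y : V) : Prop :=
  x ≠ y ∧ ∀ z : V, (∃ p : M.Walk z x, p.IsHamiltonian) ∨ (∃ p : M.Walk z y, p.IsHamiltonian)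

/-- HCTV graphs (homogeneously connected from two vertices): `K₁`, and the graphs with a pair of
anchors. -/
def IsHCTV (M : SimpleGraph V) : Prop :=
  Nat.card V = 1 ∨ ∃ x y : V, M.IsAnchorPair x y

end SimpleGraph

universe u v w z

/-- The choices made when every vertex `x` of the multigraph `L` is inflated with the complete graph
on `K x` and, after that, the graph `M e` is inserted in every edge `e` of `L`.

The two ends of each edge are named by `Bool`. The end `b` of the edge `e` is attached to the
inflation vertex `port e b` of the complete graph that replaces the vertex `ends e b`; different
edge-ends at the same vertex are attached to different inflation vertices. When `M e` is inserted
in `e`, the inflation vertex at the end `b` of `e` is joined to `anchor e b`, where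
`anchor e false`, `anchor e true` are the anchors of `M e`, or both are the only vertex of `M e`
if `M e` is `K₁`. -/
structure InflationInsertion {α : Type u} {β : Type v} (L : Graph α β)
    (K : V(L) → Type w) {W : E(L) → Type z} (M : ∀ e : E(L), SimpleGraph (W e)) where
  ends : E(L) → Bool → V(L)
  isLink_ends : ∀ e : E(L), L.IsLink e (ends e false) (ends e true)
  port : ∀ (e : E(L)) (b : Bool), K (ends e b)
  port_injective : Function.Injective
    (fun h : E(L) × Bool => (⟨ends h.1 h.2, port h.1 h.2⟩ : Σ x : V(L), K x))
  anchor : ∀ e : E(L), Bool → W e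
  anchor_spec : ∀ e : E(L),
    Nat.card (W e) = 1 ∨ (M e).IsAnchorPair (anchor e false) (anchor e true)

namespace InflationInsertion

variable {α : Type u} {β : Type v} {L : Graph α β} {K : V(L) → Type w} {W : E(L) → Type z}
  {M : ∀ e : E(L), SimpleGraph (W e)}

/-- Adjacency in the graph obtained by inflating the vertices and inserting in the edges. -/
def Adj (D : InflationInsertion L K M) :
    (Σ x : V(L), K x) ⊕ (Σ e : E(L), W e) → (Σ x : V(L), K x) ⊕ (Σ e : E(L), W e) → Prop
  | .inl a, .inl b => a ≠ b ∧ a.1 = b.1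
  | .inl a, .inr c => ∃ b : Bool, a = ⟨D.ends c.1 b, D.port c.1 b⟩ ∧ c.2 = D.anchor c.1 b
  | .inr c, .inl a => ∃ b : Bool, a = ⟨D.ends c.1 b, D.port c.1 b⟩ ∧ c.2 = D.anchor c.1 b
  | .inr c, .inr d => ∃ (e : E(L)) (s t : W e), c = ⟨e, s⟩ ∧ d = ⟨e, t⟩ ∧ (M e).Adj s t

/-- The simple graph obtained by inflating the vertices and inserting in the edges. Its vertices are
those of the complete graphs together with those of the inserted graphs. -/
def graph (D : InflationInsertion L K M) :
    SimpleGraph ((Σ x : V(L), K x) ⊕ (Σ e : E(L), W e)) where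
  Adj := D.Adj
  symm := by
    constructor
    rintro (a | c) (b | d) h
    · exact ⟨h.1.symm, h.2.symm⟩
    · exact h
    · exact h
    · obtain ⟨e, s, t, hc, hd, hst⟩ := h
      exact ⟨e, t, s, hd, hc, hst.symm⟩
  loopless := by
    constructor
    rintro (a | c) h
    · exact h.1 rfl
    · obtain ⟨e, s, t, hc, hd, hst⟩ := h
      obtain rfl : s = t := by
        have := hc.symm.trans hd
        simpa using this
      exact hst.ne rfl

end InflationInsertion

/-- The choices made when the vertices of `L` are inflated with complete graphs of the orders
`n x` and `K₁` is inserted in every edge. -/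
abbrev K1Insertion {α : Type u} {β : Type v} (L : Graph α β) (n : V(L) → ℕ) :=
  InflationInsertion L (fun x => Fin (n x)) (fun _ : E(L) => (⊤ : SimpleGraph (Fin 1)))

/-- The complete graph `K₄`, as a multigraph. -/
abbrev k4 : Graph (Fin 4) (Sym2 (Fin 4)) := Graph.ofSimpleGraph (⊤ : SimpleGraph (Fin 4))

/-! Write t for t(L). The detour order of every vertex of F is (number of inflation vertices) + t·m,
and part 1 follows from this together with t < |E(L)|. Upper bound: a path of F cannot pass through
the graph inserted in an edge twice, since its only exits are two attachments. Hence the edges whose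
inserted graphs it meets are the edges of a trail of L (`exists_trail_of_isPath`), so it meets at
most t < |E(L)| of them. This gives nontraceability and bounds the length. Lower bound: a trail of L
lifts to a path of F that crosses each inserted graph completely and collects the spare vertices of
a clique at the last visit to it (`exists_path_of_trail`). By (A-2) a suitable spanning longest
trail is available for every starting vertex of F. If the start is the attachment of the first edge,
or lies in an inserted graph, the clique at the initial vertex is left over for later; this works
because such a trail returns to its initial vertex (`left_mem_of_isTrailFrom`). The two cubic
multigraphs have four vertices of odd degree, so no trail uses all six edges, while explicit trails
have length five. The two graphs of order 18 differ because parallel edges of L leave a trace in F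
that isomorphisms preserve (`HasParallelPaths`). -/

namespace Graph

/-! ### Basic facts on trails. -/

variable {α : Type*} {β : Type*} {L : Graph α β}

lemma IsWalkFrom.edge_mem {x : α} {p : List (β × α)} (h : L.IsWalkFrom x p) {e : β}
    (he : e ∈ p.map Prod.fst) : e ∈ E(L) := by
  induction p generalizing x with
  | nil => simp at he
  | cons a p ih =>
    obtain ⟨f, y⟩ := a
    rcases List.mem_cons.1 he with rfl | he
    · exact h.1.edge_mem
    · exact ih h.2 he

lemma IsTrailFrom.length_le_ncard {x : α} {p : List (β × α)} (hE : E(L).Finite)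
    (h : L.IsTrailFrom x p) : p.length ≤ E(L).ncard := by
  classical
  rw [← List.length_map (f := Prod.fst), ← List.toFinset_card_of_nodup h.2,
    ← Set.ncard_coe_finset]
  exact Set.ncard_le_ncard (fun e he => h.1.edge_mem (by simpa using he)) hE

lemma IsTrailFrom.length_le_maxTrailLength {x : α} {p : List (β × α)} (hE : E(L).Finite)
    (h : L.IsTrailFrom x p) : p.length ≤ L.maxTrailLength :=
  le_csSup ⟨E(L).ncard, by rintro k ⟨x, p, hp, rfl⟩; exact hp.length_le_ncard hE⟩ ⟨x, p, h, rfl⟩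

lemma IsTrailFrom.of_cons {x y : α} {e : β} {p : List (β × α)} (h : L.IsTrailFrom x ((e, y) :: p)) :
    L.IsTrailFrom y p :=
  ⟨h.1.2, (List.nodup_cons.1 h.2).2⟩

lemma IsTrailFrom.cons {x y : α} {e : β} {p : List (β × α)} (h : L.IsTrailFrom y p)
    (hl : L.IsLink e x y) (he : e ∉ p.map Prod.fst) : L.IsTrailFrom x ((e, y) :: p) :=
  ⟨⟨hl, h.1⟩, List.nodup_cons.2 ⟨he, h.2⟩⟩

lemma isTrailFrom_singleton {x y : α} {e : β} (h : L.IsLink e x y) : L.IsTrailFrom x [(e, y)] :=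
  ⟨⟨h, h.right_mem⟩, by simp⟩

/-- An end of an edge of a walk is a vertex of the walk. -/
lemma IsWalkFrom.mem_of_inc {x : α} {p : List (β × α)} (h : L.IsWalkFrom x p) {e : β} {z : α}
    (he : e ∈ p.map Prod.fst) (hz : L.Inc e z) : z ∈ x :: p.map Prod.snd := by
  induction p generalizing x with
  | nil => simp at he
  | cons a p ih =>
    obtain ⟨f, y⟩ := a
    rcases List.mem_cons.1 he with rfl | he
    · rcases hz.eq_or_eq_of_isLink h.1 with rfl | rfl <;> simp
    · exact List.mem_cons_of_mem _ (ih h.2 he)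

end Graph

namespace SimpleGraph

/-- Frees hamiltonicity from the classical `DecidableEq` instance in its definition;
`IsAnchorPair.exists_isPath` does the same for anchors. -/
lemma IsTraceable.exists_isPath {V : Type*} {G : SimpleGraph V} (h : G.IsTraceable) :
    ∃ (x y : V) (p : G.Walk x y), p.IsPath ∧ ∀ z, z ∈ p.support := by
  classical
  obtain ⟨x, y, p, hp⟩ := h
  exact ⟨x, y, p, hp.isPath, hp.mem_support⟩

end SimpleGraph

/-! ### Upper bound: paths of the inflated graph give trails of the multigraph. -/

namespace InflationInsertion

variable {α : Type u} {β : Type v} {L : Graph α β} {K : V(L) → Type w} {W : E(L) → Type z}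
  {M : ∀ e : E(L), SimpleGraph (W e)} (D : InflationInsertion L K M)

/-- The inflation vertex to which the end `b` of the edge `e` is attached. -/
def portVertex (e : E(L)) (b : Bool) : Σ x : V(L), K x := ⟨D.ends e b, D.port e b⟩

lemma portVertex_inj {e f : E(L)} {b c : Bool} (h : D.portVertex e b = D.portVertex f c) :
    e = f ∧ b = c := by
  have := @D.port_injective (e, b) (f, c) h
  simpa using this

lemma isLink_ends_not (e : E(L)) (b : Bool) : L.IsLink e (D.ends e b) (D.ends e !b) := by
  cases b
  · exact D.isLink_ends e
  · exact (D.isLink_ends e).symm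

lemma exists_ends_of_isLink {e : E(L)} {x y : α} (h : L.IsLink e x y) :
    ∃ b, (D.ends e b : α) = x ∧ (D.ends e !b : α) = y := by
  rcases h.eq_and_eq_or_eq_and_eq (D.isLink_ends e) with ⟨h1, h2⟩ | ⟨h1, h2⟩
  · exact ⟨false, h1.symm, h2.symm⟩
  · exact ⟨true, h1.symm, h2.symm⟩

lemma adj_inl_inl {a b : Σ x : V(L), K x} :
    D.graph.Adj (.inl a) (.inl b) ↔ a ≠ b ∧ a.1 = b.1 := Iff.rfl

lemma adj_inl_inr {a : Σ x : V(L), K x} {e : E(L)} {s : W e} :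
    D.graph.Adj (.inl a) (.inr ⟨e, s⟩) ↔ ∃ b, a = D.portVertex e b ∧ s = D.anchor e b := Iff.rfl

lemma adj_inr_inl {a : Σ x : V(L), K x} {e : E(L)} {s : W e} :
    D.graph.Adj (.inr ⟨e, s⟩) (.inl a) ↔ ∃ b, a = D.portVertex e b ∧ s = D.anchor e b := Iff.rfl

lemma adj_inr_inr {e f : E(L)} {s : W e} {t : W f} (h : D.graph.Adj (.inr ⟨e, s⟩) (.inr ⟨f, t⟩)) :
    e = f := by
  obtain ⟨g, s, t, hc, hd, -⟩ := h
  exact (congrArg Sigma.fst hc).trans (congrArg Sigma.fst hd).symm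

lemma adj_inr_inr_same {e : E(L)} {s t : W e} (h : (M e).Adj s t) :
    D.graph.Adj (.inr ⟨e, s⟩) (.inr ⟨e, t⟩) := ⟨e, s, t, rfl, rfl, h⟩

/-- A walk that enters the graph inserted in `e` uses an attachment of `e`. -/
lemma exists_anchor_mem_support {a : Σ x : V(L), K x}
    {u v : (Σ x : V(L), K x) ⊕ (Σ e : E(L), W e)} (p : D.graph.Walk u v) (hu : u = .inl a)
    {e : E(L)} (he : ∃ s, .inr ⟨e, s⟩ ∈ p.support) :
    ∃ b, .inl (D.portVertex e b) ∈ p.support ∧ .inr ⟨e, D.anchor e b⟩ ∈ p.support := by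
  -- Removing the first vertex may leave a walk that starts inside the graph inserted in `e`, so the
  -- induction keeps this case as an alternative.
  suffices H : ∀ {u v : (Σ x : V(L), K x) ⊕ (Σ e : E(L), W e)} (p : D.graph.Walk u v),
      (∃ s, .inr ⟨e, s⟩ ∈ p.support) → (∃ s, u = .inr ⟨e, s⟩) ∨
        ∃ b, .inl (D.portVertex e b) ∈ p.support ∧ .inr ⟨e, D.anchor e b⟩ ∈ p.support by
    rcases H p he with ⟨s, hs⟩ | h
    · simp [hu] at hs
    · exact h
  intro u v p
  induction p with
  | nil =>
    rintro ⟨s, hs⟩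
    exact .inl ⟨s, by simpa using Eq.symm (by simpa using hs)⟩
  | @cons u w v h p ih =>
    rintro ⟨s, hs⟩
    rw [SimpleGraph.Walk.support_cons, List.mem_cons] at hs
    rcases hs with hs | hs
    · exact .inl ⟨s, hs.symm⟩
    rcases ih ⟨s, hs⟩ with ⟨t, rfl⟩ | ⟨b, hb, hb'⟩
    · rcases u with a | ⟨f, r⟩
      · obtain ⟨b, rfl, rfl⟩ := D.adj_inl_inr.1 h
        exact .inr ⟨b, by simp, by simp⟩
      · obtain rfl := D.adj_inr_inr h
        exact .inl ⟨r, rfl⟩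
    · exact .inr ⟨b, by simp [hb], by simp [hb']⟩

/-- The edges of `L` whose inserted graphs are met by a path form a trail. -/
lemma exists_trail_of_isPath {u v : (Σ x : V(L), K x) ⊕ (Σ e : E(L), W e)}
    (p : D.graph.Walk u v) (hp : p.IsPath) :
    (∃ x q, L.IsTrailFrom x q ∧ ∀ e : E(L), e.1 ∈ q.map Prod.fst ↔
      ∃ s, .inr ⟨e, s⟩ ∈ p.support) ∧
    (∀ a, u = .inl a → ∃ q, L.IsTrailFrom a.1 q ∧ ∀ e : E(L), e.1 ∈ q.map Prod.fst ↔
      ∃ s, .inr ⟨e, s⟩ ∈ p.support) ∧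
    (∀ f t b, u = .inr ⟨f, t⟩ → .inl (D.portVertex f b) ∉ p.support →
      ∃ q, L.IsTrailFrom (D.ends f b) q ∧ ∀ e : E(L), e.1 ∈ q.map Prod.fst ↔
      ∃ s, .inr ⟨e, s⟩ ∈ p.support) := by
  -- The last two clauses fix the initial vertex of the trail, so that an edge can be put in front
  -- of it. In the third, the path starts inside the graph inserted in `f` and avoids the attachment
  -- at the end `b`; this attachment could still precede the path, so the trail must be able to
  -- start with `f` at that end.
  induction p with
  | @nil u =>
    rcases u with a | ⟨f, t⟩
    · have : L.IsTrailFrom a.1 [] := ⟨a.1.2, List.nodup_nil⟩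
      refine ⟨⟨_, _, this, by simp⟩, ?_, by simp⟩
      rintro _ ⟨⟩
      exact ⟨_, this, by simp⟩
    · have key (b : Bool) : ∃ q, L.IsTrailFrom (D.ends f b) q ∧ ∀ e : E(L), e.1 ∈ q.map Prod.fst ↔
          ∃ s, .inr ⟨e, s⟩ ∈ (SimpleGraph.Walk.nil : D.graph.Walk (.inr ⟨f, t⟩) _).support := by
        refine ⟨_, Graph.isTrailFrom_singleton (D.isLink_ends_not f b), fun e => ?_⟩
        constructor
        · intro h
          obtain rfl : e = f := by simpa [Subtype.ext_iff] using h
          exact ⟨t, by simp⟩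
        · rintro ⟨s, hs⟩
          obtain ⟨rfl, -⟩ : e = f ∧ _ := by simpa using hs
          simp
      refine ⟨⟨_, key true⟩, by simp, ?_⟩
      rintro _ _ b ⟨⟩ -
      exact key b
  | @cons u w v h p ih =>
    obtain ⟨hp, hu⟩ := (SimpleGraph.Walk.cons_isPath_iff _ _).1 hp
    obtain ⟨ih1, ih2, ih3⟩ := ih hp
    simp only [SimpleGraph.Walk.support_cons, List.mem_cons]
    rcases u with a | ⟨f, r⟩
    · obtain ⟨q, hq⟩ : ∃ q, L.IsTrailFrom a.1 q ∧ ∀ e : E(L), e.1 ∈ q.map Prod.fst ↔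
          ∃ s, .inr ⟨e, s⟩ ∈ p.support := by
        rcases w with c | ⟨g, t⟩
        · rw [((D.adj_inl_inl).1 h).2]
          exact ih2 c rfl
        · obtain ⟨b, rfl, rfl⟩ := D.adj_inl_inr.1 h
          exact ih3 g _ b rfl hu
      refine ⟨⟨a.1, q, ?_⟩, ?_, by simp⟩
      · simpa using hq
      · rintro _ ⟨⟩
        exact ⟨q, by simpa using hq⟩
    · rcases w with c | ⟨g, t⟩
      · obtain ⟨b, rfl, rfl⟩ := D.adj_inr_inl.1 h
        obtain ⟨q, hq, hq'⟩ := ih2 _ rfl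
        by_cases hf : ∃ s, .inr ⟨f, s⟩ ∈ p.support
        · have hm (e : E(L)) : (∃ s, (.inr ⟨e, s⟩ : (Σ x : V(L), K x) ⊕ (Σ e : E(L), W e)) =
              .inr ⟨f, D.anchor f b⟩ ∨ .inr ⟨e, s⟩ ∈ p.support) ↔ ∃ s, .inr ⟨e, s⟩ ∈ p.support := by
            constructor
            · rintro ⟨s, hs | hs⟩
              · obtain ⟨rfl, -⟩ : e = f ∧ _ := by simpa using hs
                exact hf
              · exact ⟨s, hs⟩
            · rintro ⟨s, hs⟩
              exact ⟨s, .inr hs⟩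
          refine ⟨⟨_, q, hq, fun e => (hq' e).trans (hm e).symm⟩, by simp, ?_⟩
          rintro _ _ c ⟨⟩ hc
          -- The attachment at `b` lies on the path, so `c` is the other end. A return to the
          -- inserted graph of `f` would use the anchor at `b`, which is the vertex just left, or
          -- the attachment at `c`, which is excluded.
          exfalso
          obtain ⟨d, hd, hd'⟩ := D.exists_anchor_mem_support p rfl hf
          by_cases hdb : d = b
          · subst hdb
            exact hu hd'
          · have hc1 : c ≠ b := by
              rintro rfl
              exact hc (.inr p.start_mem_support)
            obtain rfl : c = d := (Bool.eq_not.2 hc1).trans (Bool.eq_not.2 hdb).symm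
            exact hc (.inr hd)
        -- The path has left the inserted graph of `f` for good, so `f` is a new edge in front of
        -- the trail.
        · have hq2 : L.IsTrailFrom (D.ends f !b) ((f.1, (D.ends f b).1) :: q) := by
            refine hq.cons (D.isLink_ends_not f b).symm ?_
            rwa [hq' f]
          have hm (e : E(L)) : e.1 ∈ ((f.1, (D.ends f b).1) :: q).map Prod.fst ↔
              ∃ s, (.inr ⟨e, s⟩ : (Σ x : V(L), K x) ⊕ (Σ e : E(L), W e)) =
              .inr ⟨f, D.anchor f b⟩ ∨ .inr ⟨e, s⟩ ∈ p.support := by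
            rw [List.map_cons, List.mem_cons, hq' e]
            constructor
            · rintro (h | ⟨s, hs⟩)
              · obtain rfl : e = f := Subtype.ext h
                exact ⟨_, .inl rfl⟩
              · exact ⟨s, .inr hs⟩
            · rintro ⟨s, hs | hs⟩
              · obtain ⟨rfl, -⟩ : e = f ∧ _ := by simpa using hs
                exact .inl rfl
              · exact .inr ⟨s, hs⟩
          refine ⟨⟨_, _, hq2, hm⟩, by simp, ?_⟩
          rintro _ _ c ⟨⟩ hc
          obtain rfl : c = !b := by
            have hc1 : c ≠ b := by
              rintro rfl
              exact hc (.inr p.start_mem_support)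
            exact Bool.eq_not.2 hc1
          exact ⟨_, hq2, hm⟩
      · obtain rfl := D.adj_inr_inr h
        have hm (e : E(L)) : (∃ s, (.inr ⟨e, s⟩ : (Σ x : V(L), K x) ⊕ (Σ e : E(L), W e)) =
            .inr ⟨f, r⟩ ∨ .inr ⟨e, s⟩ ∈ p.support) ↔ ∃ s, .inr ⟨e, s⟩ ∈ p.support := by
          constructor
          · rintro ⟨s, hs | hs⟩
            · obtain ⟨rfl, -⟩ : e = f ∧ _ := by simpa using hs
              exact ⟨t, p.start_mem_support⟩
            · exact ⟨s, hs⟩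
          · rintro ⟨s, hs⟩
            exact ⟨s, .inr hs⟩
        simp only [hm]
        refine ⟨ih1, by simp, ?_⟩
        rintro _ _ b ⟨⟩ hb
        exact ih3 f t b rfl (fun h => hb (.inr h))

/-- A path meets at most `L.maxTrailLength` of the inserted graphs. -/
lemma exists_finset_of_isPath (hE : E(L).Finite) {u v : (Σ x : V(L), K x) ⊕ (Σ e : E(L), W e)}
    (p : D.graph.Walk u v) (hp : p.IsPath) :
    ∃ T : Finset E(L), T.card ≤ L.maxTrailLength ∧
      ∀ c : Σ e : E(L), W e, .inr c ∈ p.support → c.1 ∈ T := by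
  classical
  obtain ⟨⟨x, q, hq, hq'⟩, -⟩ := D.exists_trail_of_isPath p hp
  refine ⟨(q.map Prod.fst).attach.toFinset.image
    (fun e => ⟨e.1, hq.1.edge_mem e.2⟩), ?_, ?_⟩
  · refine (Finset.card_image_le.trans (List.toFinset_card_le _)).trans ?_
    simpa using hq.length_le_maxTrailLength hE
  · rintro ⟨e, s⟩ hc
    have := (hq' e).2 ⟨s, hc⟩
    rw [Finset.mem_image]
    exact ⟨⟨e.1, this⟩, by simp, rfl⟩

lemma length_support_le (hE : E(L).Finite) {m : ℕ} [Finite (Σ x : V(L), K x)]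
    [∀ e, Finite (W e)] (hm : ∀ e, Nat.card (W e) = m)
    {u v : (Σ x : V(L), K x) ⊕ (Σ e : E(L), W e)} (p : D.graph.Walk u v) (hp : p.IsPath) :
    p.support.length ≤ Nat.card (Σ x : V(L), K x) + L.maxTrailLength * m := by
  classical
  have := Fintype.ofFinite (Σ x : V(L), K x)
  have (e : E(L)) := Fintype.ofFinite (W e)
  obtain ⟨T, hT, hT'⟩ := D.exists_finset_of_isPath hE p hp
  rw [← List.toFinset_card_of_nodup hp.support_nodup]
  have hsub : p.support.toFinset ⊆ Finset.univ.image Sum.inl ∪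
      T.biUnion fun e => Finset.univ.image fun s : W e => Sum.inr ⟨e, s⟩ := by
    rintro (a | ⟨e, s⟩) h
    · simp
    · exact Finset.mem_union_right _ (Finset.mem_biUnion.2 ⟨e, hT' _ (List.mem_toFinset.1 h),
        Finset.mem_image_of_mem _ (Finset.mem_univ s)⟩)
  refine (Finset.card_le_card hsub).trans ((Finset.card_union_le _ _).trans ?_)
  refine add_le_add ?_ ?_
  · rw [Nat.card_eq_fintype_card]
    exact Finset.card_image_le
  · refine (Finset.card_biUnion_le_card_mul _ _ m fun e _ => ?_).trans
      (Nat.mul_le_mul_right _ hT)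
    rw [← hm e, Nat.card_eq_fintype_card]
    exact Finset.card_image_le

/-- A hamiltonian path would meet every inserted graph, but a path meets at most `L.maxTrailLength`
of them. -/
lemma not_isTraceable (hE : E(L).Finite) [∀ e, Nonempty (W e)]
    (hlt : L.maxTrailLength < E(L).ncard) : ¬ D.graph.IsTraceable := by
  intro h
  obtain ⟨u, v, p, hp, hall⟩ := h.exists_isPath
  obtain ⟨T, hT, hT'⟩ := D.exists_finset_of_isPath hE p hp
  have := hE.fintype
  have hT2 : T = Finset.univ := Finset.eq_univ_iff_forall.2 fun e =>
    hT' ⟨e, Classical.arbitrary _⟩ (hall _)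
  rw [hT2, Finset.card_univ, ← Nat.card_eq_fintype_card, Nat.card_coe_set_eq] at hT
  omega

end InflationInsertion

/-! ### Spanning longest trails return to their initial vertex. -/

namespace Graph

variable {α : Type*} {β : Type*} {L : Graph α β}

/-- A spanning longest trail of an admissible multigraph returns to its initial vertex. -/
lemma IsAdmissible.left_mem_of_isTrailFrom (hL : L.IsAdmissible) (hE : E(L).Finite) {x y : α} {e : β}
    {q : List (β × α)} (h : L.IsTrailFrom x ((e, y) :: q))
    (hlen : ((e, y) :: q).length = L.maxTrailLength)
    (hV : ∀ z ∈ V(L), z ∈ x :: ((e, y) :: q).map Prod.snd) : x ∈ y :: q.map Prod.snd := by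
  by_contra hx
  have hxe : L.IsLink e x y := h.1.1
  -- An edge at `x` that the trail does not use could be put in front of it, against maximality; a
  -- used one other than `e` would bring the trail back to `x`.
  have honly : ∀ f, L.Inc f x → f = e := by
    intro f hf
    by_contra hfe
    have hfq : f ∉ ((e, y) :: q).map Prod.fst := by
      intro hmem
      rw [List.map_cons, List.mem_cons] at hmem
      exact hx (h.of_cons.1.mem_of_inc (hmem.resolve_left hfe) hf)
    obtain ⟨z, hz⟩ := hf
    have := (h.cons hz.symm hfq).length_le_maxTrailLength hE
    rw [List.length_cons, hlen] at this
    omega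
  -- The longest trail that enters `x` from `y` along `e` is stuck there, so longest trails have
  -- length one.
  obtain ⟨x', r, hr, hrlen, -⟩ := hL.exists_trail y e hxe.inc_right
  obtain rfl : x = x' := hxe.symm.right_unique hr.1.1
  have hr0 : r = [] := by
    cases r with
    | nil => rfl
    | cons a r =>
      have h1 := honly a.1 ⟨_, hr.1.2.1⟩
      have h2 := hr.2
      simp [h1] at h2
  have hT : L.maxTrailLength = 1 := by rw [← hrlen, hr0]; rfl
  have hq : q = [] := by
    rw [hT] at hlen
    exact List.length_eq_zero_iff.1 (by simpa using hlen)
  subst hq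
  -- The only vertices are `x` and `y`, and `f` avoids `x`; thus `f` is a loop at `y`, and `f`, `e`
  -- form a trail of length two.
  obtain ⟨f, hf, hfe⟩ : ∃ f ∈ E(L), f ≠ e :=
    Set.exists_ne_of_one_lt_ncard (by have := hL.maxTrailLength_lt; omega) e
  obtain ⟨z, w, hzw⟩ := L.exists_isLink_of_mem_edgeSet hf
  have hy (v : α) (hv : L.Inc f v) : v = y := by
    have h1 : v ≠ x := by
      rintro rfl
      exact hfe (honly f hv)
    simpa [h1] using hV v hv.vertex_mem
  obtain rfl := hy z hzw.inc_left
  obtain rfl := hy w hzw.inc_right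
  have := ((isTrailFrom_singleton hxe.symm).cons hzw
    (by simpa using hfe)).length_le_maxTrailLength hE
  simp [hT] at this

end Graph

/-! ### Lower bound: lifting a trail to a path. -/

namespace SimpleGraph

lemma Walk.IsPath.exists_append {V : Type*} {G : SimpleGraph V} {u v w y : V} {p : G.Walk u v}
    {q : G.Walk w y} (hp : p.IsPath) (hq : q.IsPath) (h : G.Adj v w)
    (hd : ∀ x ∈ p.support, x ∉ q.support) :
    ∃ r : G.Walk u y, r.IsPath ∧ ∀ x, x ∈ r.support ↔ x ∈ p.support ∨ x ∈ q.support := by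
  have hs : (p.append (.cons h q)).support = p.support ++ q.support := by
    simp [Walk.support_append]
  refine ⟨p.append (.cons h q), ?_, by simp [hs]⟩
  rw [Walk.isPath_def, hs, List.nodup_append]
  exact ⟨hp.support_nodup, hq.support_nodup, fun a ha b hb hab => hd a ha (hab ▸ hb)⟩

lemma IsAnchorPair.exists_isPath {V : Type*} {M : SimpleGraph V} {x y : V}
    (h : M.IsAnchorPair x y) (z : V) : (∃ p : M.Walk z x, p.IsPath ∧ ∀ s, s ∈ p.support) ∨
      ∃ p : M.Walk z y, p.IsPath ∧ ∀ s, s ∈ p.support := by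
  classical
  rcases h.2 z with ⟨p, hp⟩ | ⟨p, hp⟩
  · exact .inl ⟨p, hp.isPath, hp.mem_support⟩
  · exact .inr ⟨p, hp.isPath, hp.mem_support⟩

end SimpleGraph

namespace InflationInsertion

variable {α : Type u} {β : Type v} {L : Graph α β} {K : V(L) → Type w} {W : E(L) → Type z}
  {M : ∀ e : E(L), SimpleGraph (W e)} (D : InflationInsertion L K M)

lemma exists_path_to_anchor (e : E(L)) (z : W e) :
    ∃ (b : Bool) (p : (M e).Walk z (D.anchor e b)), p.IsPath ∧ ∀ s, s ∈ p.support := by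
  rcases D.anchor_spec e with h | h
  · have := (Nat.card_eq_one_iff_unique.1 h).1
    obtain rfl : z = D.anchor e false := Subsingleton.elim _ _
    exact ⟨false, .nil, .nil, fun s => by simp [Subsingleton.elim s (D.anchor e false)]⟩
  · rcases h.exists_isPath z with ⟨p, hp⟩ | ⟨p, hp⟩
    · exact ⟨false, p, hp⟩
    · exact ⟨true, p, hp⟩

/-- The hamiltonian path that starts at one anchor must end at the other: a path that ends where it
starts is trivial and misses the second anchor. -/
lemma exists_path_anchor_anchor (e : E(L)) (b : Bool) :
    ∃ p : (M e).Walk (D.anchor e b) (D.anchor e !b), p.IsPath ∧ ∀ s, s ∈ p.support := by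
  rcases D.anchor_spec e with h | h
  · have := (Nat.card_eq_one_iff_unique.1 h).1
    rw [Subsingleton.elim (D.anchor e b) (D.anchor e !b)]
    exact ⟨.nil, .nil, fun s => by simp [Subsingleton.elim s (D.anchor e !b)]⟩
  · have hne : D.anchor e b ≠ D.anchor e !b := by cases b <;> simp [h.1, h.1.symm]
    obtain ⟨c, p, hp, hall⟩ := D.exists_path_to_anchor e (D.anchor e b)
    by_cases hc : c = b
    · subst hc
      obtain rfl := (SimpleGraph.Walk.isPath_iff_nil.1 hp).eq_nil
      exact absurd (by simpa using hall (D.anchor e !c)) hne.symm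
    · obtain rfl := Bool.eq_not.2 hc
      exact ⟨p, hp, hall⟩

/-- The inclusion of an inserted graph. -/
def insertHom (e : E(L)) : M e →g D.graph where
  toFun s := .inr ⟨e, s⟩
  map_rel' h := D.adj_inr_inr_same h

lemma insertHom_injective (e : E(L)) : Function.Injective (D.insertHom e) := by
  intro s t h
  simpa [insertHom] using h

lemma exists_path_insert {e : E(L)} {s t : W e} {p : (M e).Walk s t} (hp : p.IsPath)
    (hall : ∀ s, s ∈ p.support) :
    ∃ r : D.graph.Walk (.inr ⟨e, s⟩) (.inr ⟨e, t⟩), r.IsPath ∧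
      ∀ x, x ∈ r.support ↔ ∃ s : W e, x = .inr ⟨e, s⟩ := by
  suffices H : ∃ r : D.graph.Walk (D.insertHom e s) (D.insertHom e t), r.IsPath ∧
      ∀ x, x ∈ r.support ↔ ∃ s : W e, x = D.insertHom e s from H
  refine ⟨p.map (D.insertHom e), hp.map (D.insertHom_injective e), fun x => ?_⟩
  rw [SimpleGraph.Walk.support_map, List.mem_map]
  constructor
  · rintro ⟨s, -, rfl⟩
    exact ⟨s, rfl⟩
  · rintro ⟨s, rfl⟩
    exact ⟨s, hall s, rfl⟩

lemma exists_path_clique (c : Σ x : V(L), K x) (C : Finset (Σ x : V(L), K x)) (hc : c ∉ C)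
    (hC : ∀ a ∈ C, a.1 = c.1) :
    ∃ (d : Σ x : V(L), K x) (p : D.graph.Walk (.inl c) (.inl d)), p.IsPath ∧
      ∀ x, x ∈ p.support ↔ ∃ a, x = .inl a ∧ (a = c ∨ a ∈ C) := by
  classical
  induction C using Finset.induction_on with
  | empty => exact ⟨c, .nil, .nil, by simp⟩
  | insert a C ha ih =>
    simp only [Finset.mem_insert, not_or, forall_eq_or_imp] at hc hC
    obtain ⟨d, p, hp, hs⟩ := ih hc.2 hC.2
    obtain ⟨_, ⟨⟩, hd⟩ := (hs _).1 p.end_mem_support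
    have hda : d ≠ a := by
      rintro rfl
      exact hd.elim (fun h => hc.1 h.symm) ha
    have hda' : d.1 = a.1 := by
      rw [hC.1]
      rcases hd with rfl | hd
      · rfl
      · exact hC.2 d hd
    obtain ⟨r, hr, hrs⟩ := hp.exists_append (SimpleGraph.Walk.IsPath.nil (u := .inl a))
      (D.adj_inl_inl.2 ⟨hda, hda'⟩) (by
        intro x hx hx'
        obtain rfl : x = .inl a := by simpa using hx'
        obtain ⟨_, ⟨⟩, h⟩ := (hs _).1 hx
        exact h.elim (fun h => hc.1 h.symm) ha)
    refine ⟨a, r, hr, fun x => ?_⟩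
    rw [hrs, hs, SimpleGraph.Walk.support_nil, List.mem_singleton]
    constructor
    · rintro (⟨b, rfl, h⟩ | rfl)
      · exact ⟨b, rfl, by simp only [Finset.mem_insert]; tauto⟩
      · exact ⟨a, rfl, by simp⟩
    · rintro ⟨b, rfl, h⟩
      simp only [Finset.mem_insert] at h
      rcases h with rfl | rfl | h
      · exact .inl ⟨_, rfl, .inl rfl⟩
      · exact .inr rfl
      · exact .inl ⟨_, rfl, .inr h⟩

/-- A path that follows a given trail of `L`, starting at the inflation vertex `c`, and visits all
the inflation vertices in `S` that it meets. -/
lemma exists_path_of_trail [Finite (Σ x : V(L), K x)] (q : List (β × α)) (c : Σ x : V(L), K x)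
    (S : Set (Σ x : V(L), K x)) (hq : L.IsTrailFrom c.1 q) (hc : c ∉ S)
    (hS : ∀ e : E(L), e.1 ∈ q.map Prod.fst → ∀ b, D.portVertex e b ∈ S) :
    ∃ (y : _) (p : D.graph.Walk (.inl c) y), p.IsPath ∧
      (∀ a, .inl a ∈ p.support ↔ a = c ∨ a ∈ S ∧ a.1.1 ∈ c.1.1 :: q.map Prod.snd) ∧
      ∀ e s, .inr ⟨e, s⟩ ∈ p.support ↔ e.1 ∈ q.map Prod.fst := by
  classical
  have := Fintype.ofFinite (Σ x : V(L), K x)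
  -- `S` holds the inflation vertices not yet used; it shrinks as the trail proceeds, hence the
  -- generalization.
  induction q generalizing c S with
  | nil =>
    obtain ⟨d, p, hp, hs⟩ := D.exists_path_clique c {a | a ∈ S ∧ a.1 = c.1} (by simp [hc]) (by simp)
    refine ⟨_, p, hp, fun a => ?_, fun e s => ?_⟩
    · simp [hs, Subtype.ext_iff]
    · simp [hs]
  | cons a q ih =>
    obtain ⟨e', y⟩ := a
    obtain ⟨e, rfl⟩ : ∃ e : E(L), e.1 = e' := ⟨⟨e', hq.1.1.edge_mem⟩, rfl⟩
    obtain ⟨b, hb, rfl⟩ := D.exists_ends_of_isLink hq.1.1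
    have hb' : (D.portVertex e b).1 = c.1 := Subtype.ext hb
    have heq : e.1 ∉ q.map Prod.fst := (List.nodup_cons.1 hq.2).1
    have hPS (b' : Bool) : D.portVertex e b' ∈ S := hS e (by simp) b'
    have hPc (b' : Bool) : D.portVertex e b' ≠ c := fun h => hc (h ▸ hPS b')
    have hPP : D.portVertex e b ≠ D.portVertex e !b := fun h => by
      simpa using (D.portVertex_inj h).2
    set C : Finset (Σ x : V(L), K x) := {a | a ∈ S ∧ a.1 = c.1 ∧ a ≠ D.portVertex e b ∧
      c.1.1 ∉ (D.ends e !b).1 :: q.map Prod.snd} with hC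
    have hmC (a : Σ x : V(L), K x) : a ∈ C ↔ a ∈ S ∧ a.1 = c.1 ∧ a ≠ D.portVertex e b ∧
      c.1.1 ∉ (D.ends e !b).1 :: q.map Prod.snd := by simp [hC]
    set S' : Set (Σ x : V(L), K x) :=
      {a | a ∈ S ∧ a ≠ D.portVertex e b ∧ a ≠ D.portVertex e !b ∧ a ∉ C} with hS'
    obtain ⟨z, p₄, hp₄, hl₄, hr₄⟩ := ih (D.portVertex e !b) S' hq.of_cons (by simp [hS']) (by
      intro f hf b'
      have hfe : f ≠ e := by rintro rfl; exact heq hf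
      refine ⟨hS f (List.mem_cons_of_mem _ hf) b', fun h => hfe (D.portVertex_inj h).1,
        fun h => hfe (D.portVertex_inj h).1, fun h => ?_⟩
      have h := (hmC _).1 h
      have h1 := hq.of_cons.1.mem_of_inc hf (D.isLink_ends_not f b').inc_left
      refine h.2.2.2 ?_
      rw [← h.2.1]
      exact h1)
    obtain ⟨d, p₁, hp₁, hs₁⟩ := D.exists_path_clique c C (by simp [hmC, hc])
      (fun a ha => ((hmC a).1 ha).2.1)
    obtain ⟨_, ⟨⟩, hd⟩ := (hs₁ _).1 p₁.end_mem_support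
    have hPC (b' : Bool) : D.portVertex e b' ∉ C := by
      intro h
      have h := (hmC _).1 h
      by_cases hbb : b' = b
      · exact h.2.2.1 (hbb ▸ rfl)
      · obtain rfl := Bool.eq_not.2 hbb
        apply h.2.2.2
        rw [← h.2.1]
        exact List.mem_cons_self
    obtain ⟨p₃, hp₃, hs₃⟩ : ∃ r : D.graph.Walk (.inr ⟨e, D.anchor e b⟩) (.inr ⟨e, D.anchor e !b⟩),
        r.IsPath ∧ ∀ x, x ∈ r.support ↔ ∃ s : W e, x = .inr ⟨e, s⟩ := by
      obtain ⟨r, hr, hall⟩ := D.exists_path_anchor_anchor e b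
      exact D.exists_path_insert hr hall
    obtain ⟨p₅, hp₅, hs₅⟩ := hp₃.exists_append hp₄ (D.adj_inr_inl.2 ⟨!b, rfl, rfl⟩) (by
      intro x hx hx'
      obtain ⟨s, rfl⟩ := (hs₃ x).1 hx
      exact heq ((hr₄ e s).1 hx'))
    obtain ⟨p₆, hp₆, hs₆⟩ := (SimpleGraph.Walk.IsPath.nil (u := .inl (D.portVertex e b))).exists_append
      hp₅ (D.adj_inl_inr.2 ⟨b, rfl, rfl⟩) (by
      intro x hx hx'
      obtain rfl : x = .inl (D.portVertex e b) := by simpa using hx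
      rw [hs₅, hs₃, hl₄] at hx'
      rcases hx' with ⟨s, hs⟩ | hx' | hx'
      · simp at hs
      · exact hPP hx'
      · exact hx'.1.2.1 rfl)
    obtain ⟨p, hp, hs⟩ := hp₁.exists_append hp₆ (D.adj_inl_inl.2 ⟨by
        rintro rfl
        exact hd.elim (hPc b) (hPC b), by
        rw [hb']
        rcases hd with rfl | hd
        · rfl
        · exact ((hmC d).1 hd).2.1⟩) (by
      intro x hx hx'
      obtain ⟨a, rfl, ha⟩ := (hs₁ x).1 hx
      rw [hs₆, hs₅, hs₃, hl₄, SimpleGraph.Walk.support_nil, List.mem_singleton] at hx'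
      rcases hx' with hx' | ⟨s, hx'⟩ | hx' | hx'
      · obtain rfl := Sum.inl_injective hx'
        exact ha.elim (hPc b) (hPC b)
      · simp at hx'
      · subst hx'
        exact ha.elim (hPc _) (hPC _)
      · rcases ha with rfl | ha
        · exact hc hx'.1.1
        · exact hx'.1.2.2.2 ha)
    refine ⟨z, p, hp, fun a => ?_, fun f s => ?_⟩
    · rw [hs, hs₁, hs₆, hs₅, hs₃, hl₄, SimpleGraph.Walk.support_nil, List.mem_singleton]
      constructor
      · rintro (⟨_, ⟨⟩, rfl | h⟩ | h | ⟨s, h⟩ | rfl | h)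
        · exact .inl rfl
        · have h := (hmC _).1 h
          exact .inr ⟨h.1, by simp [h.2.1]⟩
        · obtain rfl := Sum.inl_injective h
          exact .inr ⟨hPS b, by simp [hb']⟩
        · simp at h
        · exact .inr ⟨hPS _, List.mem_cons_of_mem _ List.mem_cons_self⟩
        · exact .inr ⟨h.1.1, List.mem_cons_of_mem _ h.2⟩
      · rintro (rfl | ⟨haS, ha⟩)
        · exact .inl ⟨_, rfl, .inl rfl⟩
        by_cases h1 : a = D.portVertex e b
        · exact .inr (.inl (h1 ▸ rfl))
        by_cases h2 : a = D.portVertex e !b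
        · exact .inr (.inr (.inr (.inl h2)))
        by_cases h3 : a ∈ C
        · exact .inl ⟨_, rfl, .inr h3⟩
        refine .inr (.inr (.inr (.inr ⟨⟨haS, h1, h2, h3⟩, ?_⟩)))
        by_contra h4
        have h5 : a.1 = c.1 := by
          rcases List.mem_cons.1 ha with h | h
          · exact Subtype.ext h
          · exact absurd h h4
        exact h3 ((hmC a).2 ⟨haS, h5, h1, h5 ▸ h4⟩)
    · rw [hs, hs₁, hs₆, hs₅, hs₃, hr₄, SimpleGraph.Walk.support_nil, List.mem_singleton,
        List.map_cons, List.mem_cons]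
      constructor
      · rintro (⟨_, h, -⟩ | h | ⟨t, h⟩ | h)
        · simp at h
        · simp at h
        · obtain ⟨rfl, -⟩ : f = e ∧ _ := by simpa using h
          exact .inl rfl
        · exact .inr h
      · rintro (h | h)
        · obtain rfl : f = e := Subtype.ext h
          exact .inr (.inr (.inl ⟨s, rfl⟩))
        · exact .inr (.inr (.inr h))

end InflationInsertion

/-! ### Detour orders, and the proof that the construction gives CND graphs. -/

namespace InflationInsertion

variable {α : Type u} {β : Type v} {L : Graph α β} {K : V(L) → Type w} {W : E(L) → Type z}
  {M : ∀ e : E(L), SimpleGraph (W e)} (D : InflationInsertion L K M)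

/-- Every vertex is the initial vertex of a path through all inflation vertices and the inserted
graphs of all edges of a longest trail. -/
lemma exists_path_of_vertex [Finite (Σ x : V(L), K x)] (hE : E(L).Finite) (hL : L.IsAdmissible)
    (u : (Σ x : V(L), K x) ⊕ (Σ e : E(L), W e)) :
    ∃ (y : _) (p : D.graph.Walk u y), p.IsPath ∧ (∀ a, .inl a ∈ p.support) ∧
      ∃ (x : α) (q : List (β × α)), L.IsTrailFrom x q ∧ q.length = L.maxTrailLength ∧
        ∀ e s, e.1 ∈ q.map Prod.fst → .inr ⟨e, s⟩ ∈ p.support := by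
  -- a spanning longest trail that starts with the end `b` of `e`
  have key (e : E(L)) (b : Bool) : ∃ q, L.IsTrailFrom (D.ends e b)
      ((e.1, (D.ends e !b).1) :: q) ∧
      ((e.1, (D.ends e !b).1) :: q).length = L.maxTrailLength ∧
      ∀ z ∈ V(L), z ∈ (D.ends e !b).1 :: q.map Prod.snd := by
    obtain ⟨y, q, hq, hlen, hV⟩ := hL.exists_trail _ _ (D.isLink_ends_not e b).inc_left
    obtain rfl := (D.isLink_ends_not e b).right_unique hq.1.1
    have hmem := hL.left_mem_of_isTrailFrom hE hq hlen hV
    refine ⟨q, hq, hlen, fun z hz => ?_⟩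
    rcases List.mem_cons.1 (hV z hz) with rfl | h
    · exact hmem
    · exact h
  have hport (e : E(L)) (b c : Bool) (q : List (β × α)) (y : α)
      (hq : L.IsTrailFrom (D.ends e b) ((e.1, y) :: q)) (f : E(L))
      (hf : f.1 ∈ q.map Prod.fst) (b' : Bool) : D.portVertex f b' ≠ D.portVertex e c := by
    intro h
    obtain rfl := (D.portVertex_inj h).1
    exact (List.nodup_cons.1 hq.2).1 hf
  rcases u with c | ⟨e, s⟩
  -- An attachment of `e` must be left along `e` at once, since it would not be available when the
  -- trail uses `e` later. The rest of its clique is visited when the trail returns.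
  · by_cases hc : ∃ e b, c = D.portVertex e b
    · obtain ⟨e, b, rfl⟩ := hc
      obtain ⟨q, hq, hlen, hV⟩ := key e b
      have hPP : D.portVertex e b ≠ D.portVertex e !b := fun h => by
        simpa using (D.portVertex_inj h).2
      obtain ⟨y, p₂, hp₂, hl₂, hr₂⟩ := D.exists_path_of_trail q (D.portVertex e !b)
        {D.portVertex e b, D.portVertex e !b}ᶜ hq.of_cons (by simp) (by
          intro f hf b'
          simp only [Set.mem_compl_iff, Set.mem_insert_iff, Set.mem_singleton_iff, not_or]
          exact ⟨hport e b _ q _ hq f hf b', hport e b _ q _ hq f hf b'⟩)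
      obtain ⟨p₁, hp₁, hs₁⟩ : ∃ r : D.graph.Walk (.inr ⟨e, D.anchor e b⟩)
          (.inr ⟨e, D.anchor e !b⟩), r.IsPath ∧
          ∀ x, x ∈ r.support ↔ ∃ s : W e, x = .inr ⟨e, s⟩ := by
        obtain ⟨r, hr, hall⟩ := D.exists_path_anchor_anchor e b
        exact D.exists_path_insert hr hall
      obtain ⟨p₃, hp₃, hs₃⟩ := hp₁.exists_append hp₂ (D.adj_inr_inl.2 ⟨!b, rfl, rfl⟩) (by
        intro x hx hx'
        obtain ⟨s, rfl⟩ := (hs₁ x).1 hx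
        exact (List.nodup_cons.1 hq.2).1 ((hr₂ e s).1 hx'))
      have hnot : .inl (D.portVertex e b) ∉ p₃.support := by
        rw [hs₃, hs₁, hl₂]
        rintro (⟨s, hs⟩ | h | h)
        · simp at hs
        · exact hPP h
        · simp at h
      refine ⟨y, .cons (D.adj_inl_inr.2 ⟨b, rfl, rfl⟩) p₃,
        (SimpleGraph.Walk.cons_isPath_iff _ _).2 ⟨hp₃, hnot⟩, fun a => ?_, _, _, hq, hlen,
        fun f s hf => ?_⟩
      · rw [SimpleGraph.Walk.support_cons, List.mem_cons, hs₃, hl₂]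
        by_cases h1 : a = D.portVertex e b
        · exact .inl (h1 ▸ rfl)
        by_cases h2 : a = D.portVertex e !b
        · exact .inr (.inr (.inl h2))
        exact .inr (.inr (.inr ⟨by simp [h1, h2], hV _ a.1.2⟩))
      · rw [SimpleGraph.Walk.support_cons, List.mem_cons, hs₃, hs₁, hr₂]
        rcases List.mem_cons.1 hf with h | h
        · obtain rfl : f = e := Subtype.ext h
          exact .inr (.inl ⟨s, rfl⟩)
        · exact .inr (.inr h)
    · push Not at hc
      -- No vertex is isolated, because a trail of positive length visits it.
      obtain ⟨f, hf⟩ : ∃ f, L.Inc f c.1 := by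
        obtain ⟨e, he⟩ : E(L).Nonempty :=
          Set.nonempty_of_ncard_ne_zero (by have := hL.maxTrailLength_lt; omega)
        obtain ⟨q, hq, hlen, hV⟩ := key ⟨e, he⟩ false
        have hmem (x : α) (r : List (β × α)) (hr : L.IsWalkFrom x r)
            (h : c.1.1 ∈ r.map Prod.snd) : ∃ f, L.Inc f c.1 := by
          induction r generalizing x with
          | nil => simp at h
          | cons a r ih =>
            rcases List.mem_cons.1 h with h | h
            · exact ⟨a.1, h ▸ hr.1.inc_right⟩
            · exact ih _ hr.2 h
        exact hmem _ _ hq.1 (hV _ c.1.2)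
      obtain ⟨y, q, hq, hlen, hV⟩ := hL.exists_trail _ _ hf
      obtain ⟨z, p, hp, hl, hr⟩ := D.exists_path_of_trail _ c {c}ᶜ hq (by simp)
        (fun f _ b => by simpa using (hc f b).symm)
      refine ⟨z, p, hp, fun a => ?_, _, _, hq, hlen, fun f s hf => (hr f s).2 hf⟩
      rw [hl]
      by_cases h1 : a = c
      · exact .inl h1
      · exact .inr ⟨by simpa using h1, hV _ a.1.2⟩
  · obtain ⟨b, r, hr, hall⟩ := D.exists_path_to_anchor e s
    -- The path leaves the inserted graph at the end `b`, so the trail has to cross `e` towards that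
    -- end.
    obtain ⟨q, hq, hlen, hV⟩ := key e !b
    rw [Bool.not_not] at hq hlen hV
    obtain ⟨p₁, hp₁, hs₁⟩ := D.exists_path_insert hr hall
    obtain ⟨y, p₂, hp₂, hl₂, hr₂⟩ := D.exists_path_of_trail q (D.portVertex e b)
      {D.portVertex e b}ᶜ hq.of_cons (by simp) (by
        intro f hf b'
        simpa using hport e (!b) _ q _ hq f hf b')
    obtain ⟨p₃, hp₃, hs₃⟩ := hp₁.exists_append hp₂ (D.adj_inr_inl.2 ⟨b, rfl, rfl⟩) (by
      intro x hx hx'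
      obtain ⟨s, rfl⟩ := (hs₁ x).1 hx
      exact (List.nodup_cons.1 hq.2).1 ((hr₂ e s).1 hx'))
    refine ⟨y, p₃, hp₃, fun a => ?_, _, _, hq, hlen, fun f s hf => ?_⟩
    · rw [hs₃, hl₂]
      by_cases h1 : a = D.portVertex e b
      · exact .inr (.inl h1)
      · exact .inr (.inr ⟨by simpa using h1, hV _ a.1.2⟩)
    · rw [hs₃, hs₁, hr₂]
      rcases List.mem_cons.1 hf with h | h
      · obtain rfl : f = e := Subtype.ext h
        exact .inl ⟨_, rfl⟩
      · exact .inr h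

/-- All inflation vertices and the `m` vertices of each inserted graph along a longest trail already
attain the bound of `length_support_le`. -/
lemma exists_path_length_support [Finite (Σ x : V(L), K x)] [∀ e, Finite (W e)]
    (hE : E(L).Finite) (hL : L.IsAdmissible) {m : ℕ} (hm : ∀ e, Nat.card (W e) = m)
    (u : (Σ x : V(L), K x) ⊕ (Σ e : E(L), W e)) :
    ∃ (y : _) (p : D.graph.Walk u y), p.IsPath ∧ (∀ a, .inl a ∈ p.support) ∧
      p.support.length = Nat.card (Σ x : V(L), K x) + L.maxTrailLength * m := by
  classical
  have := Fintype.ofFinite (Σ x : V(L), K x)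
  have (e : E(L)) := Fintype.ofFinite (W e)
  obtain ⟨y, p, hp, hl, x, q, hq, hlen, hr⟩ := D.exists_path_of_vertex hE hL u
  refine ⟨y, p, hp, hl, le_antisymm (D.length_support_le hE hm p hp) ?_⟩
  set l : List E(L) := (q.map Prod.fst).attach.map fun e => ⟨e.1, hq.1.edge_mem e.2⟩ with hl'
  have hnd : l.Nodup := by
    refine (List.nodup_attach.2 hq.2).map fun a b h => ?_
    simpa [Subtype.ext_iff] using h
  set T : Finset E(L) := l.toFinset with hT
  have hTc : T.card = L.maxTrailLength := by
    rw [hT, List.toFinset_card_of_nodup hnd, hl', List.length_map, List.length_attach,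
      List.length_map, hlen]
  have hTm (e : E(L)) (he : e ∈ T) : e.1 ∈ q.map Prod.fst := by
    obtain ⟨f, -, rfl⟩ := List.mem_map.1 (List.mem_toFinset.1 he)
    exact f.2
  have hWm (e : E(L)) : (Finset.univ : Finset (W e)).card = m := by
    rw [← hm e, Nat.card_eq_fintype_card, Finset.card_univ]
  have hcard : ((Finset.univ : Finset (Σ x : V(L), K x)).disjSum
      (T.sigma fun e => (Finset.univ : Finset (W e)))).card =
      Nat.card (Σ x : V(L), K x) + L.maxTrailLength * m := by
    rw [Finset.card_disjSum, Finset.card_sigma, ← hTc, Finset.card_univ, Nat.card_eq_fintype_card,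
      Finset.sum_const_nat fun e _ => hWm e]
  rw [← hcard, ← List.toFinset_card_of_nodup hp.support_nodup]
  refine Finset.card_le_card ?_
  rintro (a | ⟨e, s⟩) h
  · exact List.mem_toFinset.2 (hl a)
  · exact List.mem_toFinset.2 (hr e s (hTm e (by simpa using h)))

lemma vertexDetourOrder_eq [Finite (Σ x : V(L), K x)] [∀ e, Finite (W e)]
    (hE : E(L).Finite) (hL : L.IsAdmissible) {m : ℕ} (hm : ∀ e, Nat.card (W e) = m)
    (u : (Σ x : V(L), K x) ⊕ (Σ e : E(L), W e)) :
    D.graph.vertexDetourOrder u = Nat.card (Σ x : V(L), K x) + L.maxTrailLength * m := by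
  obtain ⟨y, p, hp, -, hlen⟩ := D.exists_path_length_support hE hL hm u
  refine IsGreatest.csSup_eq ⟨⟨y, p, hp, hlen⟩, ?_⟩
  rintro _ ⟨y, p, hp, rfl⟩
  exact D.length_support_le hE hm p hp

lemma detourOrder_eq [Finite (Σ x : V(L), K x)] [∀ e, Finite (W e)]
    (hE : E(L).Finite) (hL : L.IsAdmissible) {m : ℕ} (hm : ∀ e, Nat.card (W e) = m)
    (u : (Σ x : V(L), K x) ⊕ (Σ e : E(L), W e)) :
    D.graph.detourOrder = Nat.card (Σ x : V(L), K x) + L.maxTrailLength * m := by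
  obtain ⟨y, p, hp, -, hlen⟩ := D.exists_path_length_support hE hL hm u
  refine IsGreatest.csSup_eq ⟨⟨u, y, p, hp, hlen⟩, ?_⟩
  rintro _ ⟨x, y, p, hp, rfl⟩
  exact D.length_support_le hE hm p hp

/-- Inflating the vertices of an admissible multigraph and inserting graphs of the same order in its
edges gives a CND graph. -/
theorem isCND [Finite (Σ x : V(L), K x)] [∀ e, Finite (W e)] [∀ e, Nonempty (W e)]
    (hE : E(L).Finite) (hL : L.IsAdmissible) {m : ℕ} (hm : ∀ e, Nat.card (W e) = m) :
    D.graph.IsCND := by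
  refine ⟨?_, D.not_isTraceable hE hL.maxTrailLength_lt, fun x y => by
    rw [D.vertexDetourOrder_eq hE hL hm, D.vertexDetourOrder_eq hE hL hm]⟩
  obtain ⟨e, he⟩ : E(L).Nonempty :=
    Set.nonempty_of_ncard_ne_zero (by have := hL.maxTrailLength_lt; omega)
  -- Connectedness is a by-product: the long path from any vertex passes through every inflation
  -- vertex.
  have hreach (u : (Σ x : V(L), K x) ⊕ (Σ e : E(L), W e)) :
      D.graph.Reachable u (.inl (D.portVertex ⟨e, he⟩ false)) := by
    classical
    obtain ⟨y, p, -, hl, -⟩ := D.exists_path_length_support hE hL hm u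
    exact ⟨p.takeUntil _ (hl _)⟩
  exact SimpleGraph.connected_iff _ |>.2
    ⟨fun u v => (hreach u).trans (hreach v).symm, ⟨.inl (D.portVertex ⟨e, he⟩ false)⟩⟩

end InflationInsertion

lemma SimpleGraph.IsHCTV.finite_and_nonempty {V : Type*} {M : SimpleGraph V} (h : M.IsHCTV) :
    Finite V ∧ Nonempty V := by
  rcases h with h | ⟨x, y, h⟩
  · exact ⟨(Nat.card_ne_zero.1 (by omega)).2, (Nat.card_ne_zero.1 (by omega)).1⟩
  · classical
    rcases h.2 x with ⟨p, hp⟩ | ⟨p, hp⟩ <;> exact ⟨hp.finite, ⟨x⟩⟩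

/-! ### Parity of trails and admissibility of the two cubic multigraphs. -/

namespace Graph

variable {α : Type*} {β : Type*} {L : Graph α β}

/-- `c e z` counts the ends of `e` at `z`. Each passage through a vertex uses two edge-ends, so only
the two ends of the walk can have odd count. -/
lemma IsWalkFrom.sum_ends_mod_two [DecidableEq α] {c : β → α → ℕ}
    (hc : ∀ e x y, L.IsLink e x y → ∀ z, c e z = (if x = z then 1 else 0) + if y = z then 1 else 0)
    {x : α} {p : List (β × α)} (h : L.IsWalkFrom x p) :
    ∃ y, ∀ z, (p.map fun a => c a.1 z).sum % 2 =
      ((if x = z then 1 else 0) + if y = z then 1 else 0) % 2 := by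
  induction p generalizing x with
  | nil =>
    refine ⟨x, fun z => ?_⟩
    split_ifs <;> simp
  | cons a p ih =>
    obtain ⟨e, w⟩ := a
    obtain ⟨y, hy⟩ := ih h.2
    refine ⟨y, fun z => ?_⟩
    have h1 := hy z
    have h2 := hc e x w h.1 z
    simp only [List.map_cons, List.sum_cons, h2]
    split_ifs at h1 ⊢ <;> omega

/-- A trail through all edges leaves at most two vertices of odd degree. -/
lemma IsTrailFrom.length_lt_card [DecidableEq α] [Fintype β] [Finite α] {c : β → α → ℕ}
    (hc : ∀ e x y, L.IsLink e x y → ∀ z, c e z = (if x = z then 1 else 0) + if y = z then 1 else 0)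
    (hc0 : ∀ e ∉ E(L), ∀ z, c e z = 0)
    (hodd : ∀ z, (∑ e, c e z) % 2 = 1) (hα : 3 ≤ Nat.card α)
    {x : α} {p : List (β × α)} (h : L.IsTrailFrom x p) : p.length < E(L).ncard := by
  classical
  have := Fintype.ofFinite α
  have hE : E(L).Finite := Set.toFinite _
  refine lt_of_le_of_ne (h.length_le_ncard hE) fun hlen => ?_
  obtain ⟨y, hy⟩ := h.1.sum_ends_mod_two hc
  have hset : (p.map Prod.fst).toFinset = hE.toFinset := by
    refine Finset.eq_of_subset_of_card_le (fun e he => ?_) ?_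
    · simpa using h.1.edge_mem (List.mem_toFinset.1 he)
    · rw [List.toFinset_card_of_nodup h.2, List.length_map, hlen, Set.ncard_eq_toFinset_card _ hE]
  have hsum (z : α) : (p.map fun a => c a.1 z).sum = ∑ e, c e z := by
    have h1 : (p.map fun a => c a.1 z) = (p.map Prod.fst).map fun e => c e z := by simp
    rw [h1, ← List.sum_toFinset _ h.2, hset]
    refine Finset.sum_subset (Finset.subset_univ _) fun e _ he => hc0 e (by simpa using he) z
  -- At a third vertex the trail uses an even number of edge-ends, but the degree there is odd.
  obtain ⟨z, hz⟩ : ∃ z, z ∉ ({x, y} : Finset α) := by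
    by_contra! hall
    have h1 := Finset.card_le_card (fun z _ => hall z : (Finset.univ : Finset α) ⊆ {x, y})
    rw [Finset.card_univ, ← Nat.card_eq_fintype_card] at h1
    have := Finset.card_le_two (a := x) (b := y)
    omega
  have h1 := hy z
  rw [hsum, hodd] at h1
  simp only [Finset.mem_insert, Finset.mem_singleton, not_or] at hz
  simp [Ne.symm hz.1, Ne.symm hz.2] at h1

lemma maxTrailLength_eq_of_forall_le {k : ℕ} {x : α} {p : List (β × α)} (hp : L.IsTrailFrom x p)
    (hk : p.length = k) (h : ∀ (y : α) (q : List (β × α)), L.IsTrailFrom y q → q.length ≤ k) :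
    L.maxTrailLength = k := by
  refine IsGreatest.csSup_eq ⟨⟨x, p, hp, hk⟩, ?_⟩
  rintro _ ⟨y, q, hq, rfl⟩
  exact h y q hq

/-- A multigraph with `k + 1` edges, no trail through all of them and enough trails of length `k` is
admissible. -/
lemma isAdmissible_of_forall {k : ℕ} (hE : E(L).ncard = k + 1)
    (hlt : ∀ (x : α) (p : List (β × α)), L.IsTrailFrom x p → p.length < E(L).ncard)
    (hex : ∀ (x : α) (e : β), L.Inc e x → ∃ (y : α) (q : List (β × α)),
      L.IsTrailFrom x ((e, y) :: q) ∧ ((e, y) :: q).length = k ∧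
      ∀ z ∈ V(L), z ∈ x :: ((e, y) :: q).map Prod.snd) :
    L.maxTrailLength = k ∧ L.IsAdmissible := by
  obtain ⟨e, he⟩ : E(L).Nonempty := Set.nonempty_of_ncard_ne_zero (by omega)
  obtain ⟨x, y, hxy⟩ := L.exists_isLink_of_mem_edgeSet he
  obtain ⟨z, q, hq, hlen, -⟩ := hex x e hxy.inc_left
  have hT : L.maxTrailLength = k := maxTrailLength_eq_of_forall_le hq hlen fun y q hq => by
    have := hlt y q hq
    omega
  refine ⟨hT, ⟨by omega, ?_⟩⟩
  rw [hT]
  exact hex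

end Graph

lemma k4_isLink {e : Sym2 (Fin 4)} {x y : Fin 4} : k4.IsLink e x y ↔ x ≠ y ∧ s(x, y) = e := by
  simp only [Graph.ofSimpleGraph, SimpleGraph.edgeSet_top]
  constructor
  · rintro ⟨rfl, h⟩
    exact ⟨by simpa using h, rfl⟩
  · rintro ⟨h, rfl⟩
    exact ⟨rfl, by simpa using h⟩

lemma k4_edgeSet : E(k4) = ((Finset.univ.filter fun e : Sym2 (Fin 4) => ¬ e.IsDiag : Finset _) :
    Set (Sym2 (Fin 4))) := by
  ext e
  simp [Graph.ofSimpleGraph]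

lemma k4_edgeSet_ncard : E(k4).ncard = 6 := by
  rw [k4_edgeSet, Set.ncard_coe_finset]
  decide

lemma k4_maxTrailLength_and_isAdmissible : k4.maxTrailLength = 5 ∧ k4.IsAdmissible := by
  refine Graph.isAdmissible_of_forall k4_edgeSet_ncard (fun x p h => ?_) fun x e h => ?_
  · refine h.length_lt_card (c := fun e z => if ¬ e.IsDiag ∧ z ∈ e then 1 else 0) ?_ ?_ ?_ (by simp)
    · intro e x y hxy z
      obtain ⟨hne, rfl⟩ := k4_isLink.1 hxy
      clear hxy
      revert x y z
      decide
    · intro e he z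
      rw [k4_edgeSet] at he
      simp at he
      simp [he]
    · decide
  · obtain ⟨y, hy⟩ := h
    obtain ⟨hne, rfl⟩ := k4_isLink.1 hy
    obtain ⟨z, w, hzw⟩ : ∃ z w : Fin 4, [x, y, z, w].Nodup := by
      clear hy
      revert x y
      decide
    -- Round the triangle `x y z`, then `x w y`; only the edge `zw` is missed.
    refine ⟨y, [(s(y, z), z), (s(z, x), x), (s(x, w), w), (s(w, y), y)], ⟨⟨hy, ?_⟩, ?_⟩, rfl, ?_⟩
    · simp only [Graph.IsWalkFrom, k4_isLink]
      simp at hzw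
      simp [Graph.ofSimpleGraph]
      tauto
    · clear hy
      revert x y z w
      decide
    · clear hy
      rintro v -
      revert x y z w v
      decide

lemma c2BoxK2_isLink_inl {j k : Bool} {x y : Bool × Bool} :
    Graph.c2BoxK2.IsLink (.inl (j, k)) x y ↔ s(x, y) = s((false, j), (true, j)) := Iff.rfl

lemma c2BoxK2_isLink_inr {i : Bool} {x y : Bool × Bool} :
    Graph.c2BoxK2.IsLink (.inr i) x y ↔ s(x, y) = s((i, false), (i, true)) := Iff.rfl

lemma c2BoxK2_edgeSet : E(Graph.c2BoxK2) = Set.univ := by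
  refine Set.eq_univ_of_forall ?_
  rintro (⟨j, k⟩ | i)
  · exact (c2BoxK2_isLink_inl.2 rfl).edge_mem
  · exact (c2BoxK2_isLink_inr.2 rfl).edge_mem

lemma c2BoxK2_edgeSet_ncard : E(Graph.c2BoxK2).ncard = 6 := by
  rw [c2BoxK2_edgeSet, Set.ncard_univ, Nat.card_eq_fintype_card]
  rfl

lemma c2BoxK2_maxTrailLength_and_isAdmissible :
    Graph.c2BoxK2.maxTrailLength = 5 ∧ Graph.c2BoxK2.IsAdmissible := by
  refine Graph.isAdmissible_of_forall c2BoxK2_edgeSet_ncard (fun x p h => ?_) fun x e h => ?_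
  · refine h.length_lt_card (c := fun e z => match e with
      | .inl (j, _) => if z.2 = j then 1 else 0
      | .inr i => if z.1 = i then 1 else 0) ?_ ?_ ?_ (by simp)
    · rintro (⟨j, k⟩ | i) x y hxy z
      · rw [c2BoxK2_isLink_inl] at hxy
        show (if z.2 = j then 1 else 0) = _
        revert j x y z
        decide
      · rw [c2BoxK2_isLink_inr] at hxy
        show (if z.1 = i then 1 else 0) = _
        revert i x y z
        decide
    · simp [c2BoxK2_edgeSet]
    · decide
  · obtain ⟨i, j⟩ := x
    obtain ⟨y, hy⟩ := h
    rcases e with ⟨j', k⟩ | i'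
    · rw [c2BoxK2_isLink_inl] at hy
      obtain ⟨rfl, rfl⟩ : j' = j ∧ y = (!i, j) := by
        revert i j j' y
        decide
      -- Round one pair of parallel edges, across, and round the other pair; only `.inr (!i)` is
      -- missed.
      refine ⟨(!i, j'), [(.inl (j', !k), (i, j')), (.inr i, (i, !j')),
        (.inl (!j', false), (!i, !j')), (.inl (!j', true), (i, !j'))], ⟨?_, ?_⟩, rfl, ?_⟩
      · simp only [Graph.IsWalkFrom, c2BoxK2_isLink_inl, c2BoxK2_isLink_inr]
        refine ⟨?_, ?_, ?_, ?_, ?_, trivial⟩ <;> revert i j' <;> decide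
      · clear hy
        revert i j' k
        decide
      · clear hy
        rintro z -
        revert i j' z k
        decide
    · rw [c2BoxK2_isLink_inr] at hy
      obtain ⟨rfl, rfl⟩ : i' = i ∧ y = (i, !j) := by
        revert i j i' y
        decide
      -- Round a four-cycle up to `(!i', j)`, then along both parallel edges there; only `.inl (!j,
      -- true)` is missed.
      refine ⟨(i', !j), [(.inl (!j, false), (!i', !j)), (.inr (!i'), (!i', j)),
        (.inl (j, false), (i', j)), (.inl (j, true), (!i', j))], ⟨?_, ?_⟩, rfl, ?_⟩
      · simp only [Graph.IsWalkFrom, c2BoxK2_isLink_inl, c2BoxK2_isLink_inr]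
        refine ⟨?_, ?_, ?_, ?_, ?_, trivial⟩ <;> revert i' j <;> decide
      · clear hy
        revert i' j
        decide
      · clear hy
        rintro z -
        revert i' j z
        decide

lemma k4_degree (x : Fin 4) : k4.degree x = 3 := by
  have h1 : k4.incidenceSet x =
      ((Finset.univ.filter fun e : Sym2 (Fin 4) => ¬ e.IsDiag ∧ x ∈ e : Finset _) :
        Set (Sym2 (Fin 4))) := by
    ext e
    induction e using Sym2.ind with | _ a b
    simp only [Graph.mem_incidenceSet, Graph.Inc, k4_isLink, Finset.coe_filter]
    revert x a b
    decide
  have h2 : k4.loopSet x = ∅ :=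
    Set.eq_empty_of_forall_notMem fun e he => (k4_isLink.1 he).1 rfl
  rw [Graph.degree, h1, h2, Set.ncard_coe_finset, Set.ncard_empty]
  clear h1 h2
  revert x
  decide

lemma c2BoxK2_not_isLink_self (e : (Bool × Bool) ⊕ Bool) (x : Bool × Bool) :
    ¬ Graph.c2BoxK2.IsLink e x x := by
  rcases e with ⟨j, k⟩ | i
  · rw [c2BoxK2_isLink_inl]
    revert j x
    decide
  · rw [c2BoxK2_isLink_inr]
    revert i x
    decide

lemma c2BoxK2_degree (x : Bool × Bool) : Graph.c2BoxK2.degree x = 3 := by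
  have h1 : Graph.c2BoxK2.incidenceSet x =
      (({.inl (x.2, false), .inl (x.2, true), .inr x.1} : Finset ((Bool × Bool) ⊕ Bool)) :
        Set ((Bool × Bool) ⊕ Bool)) := by
    ext e
    rcases e with ⟨j, k⟩ | i
    · simp only [Graph.mem_incidenceSet, Graph.Inc, c2BoxK2_isLink_inl, Finset.mem_coe]
      revert j k x
      decide
    · simp only [Graph.mem_incidenceSet, Graph.Inc, c2BoxK2_isLink_inr, Finset.mem_coe]
      revert i x
      decide
  have h2 : Graph.c2BoxK2.loopSet x = ∅ :=
    Set.eq_empty_of_forall_notMem fun e => c2BoxK2_not_isLink_self e x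
  rw [Graph.degree, h1, h2, Set.ncard_coe_finset, Set.ncard_empty]
  clear h1 h2
  revert x
  decide

/-! ### An invariant that detects parallel edges, and the size of the examples. -/

namespace SimpleGraph

/-- Two vertices outside triangles are joined by two paths of length three, the first steps of which
end at different vertices. -/
def HasParallelPaths {V : Type*} (G : SimpleGraph V) : Prop :=
  ∃ c d p₁ p₂ q₁ q₂ : V, c ≠ d ∧ p₁ ≠ p₂ ∧
    (∀ a b, G.Adj c a → G.Adj c b → ¬ G.Adj a b) ∧ (∀ a b, G.Adj d a → G.Adj d b → ¬ G.Adj a b) ∧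
    G.Adj c p₁ ∧ G.Adj c p₂ ∧ G.Adj d q₁ ∧ G.Adj d q₂ ∧ G.Adj p₁ q₁ ∧ G.Adj p₂ q₂

lemma HasParallelPaths.map {V V' : Type*} {G : SimpleGraph V} {G' : SimpleGraph V'} (f : G ≃g G')
    (h : G.HasParallelPaths) : G'.HasParallelPaths := by
  obtain ⟨c, d, p₁, p₂, q₁, q₂, hcd, hp, hc, hd, h⟩ := h
  have key (c : V) (hc : ∀ a b, G.Adj c a → G.Adj c b → ¬ G.Adj a b) (a b : V')
      (ha : G'.Adj (f c) a) (hb : G'.Adj (f c) b) : ¬ G'.Adj a b := by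
    obtain ⟨a, rfl⟩ := f.surjective a
    obtain ⟨b, rfl⟩ := f.surjective b
    rw [f.map_adj_iff] at *
    exact hc a b ha hb
  refine ⟨f c, f d, f p₁, f p₂, f q₁, f q₂, f.injective.ne hcd, f.injective.ne hp, key c hc,
    key d hd, ?_⟩
  simpa only [f.map_adj_iff] using h

end SimpleGraph

namespace InflationInsertion

variable {α : Type u} {β : Type v} {L : Graph α β}

lemma exists_port_of_adj_insert (D : K1Insertion L fun _ => 3) {e : E(L)}
    {p : (Σ _ : V(L), Fin 3) ⊕ (Σ _ : E(L), Fin 1)} (h : D.graph.Adj (.inr ⟨e, 0⟩) p) :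
    ∃ b, p = .inl (D.portVertex e b) := by
  rcases p with a | ⟨f, s⟩
  · obtain ⟨b, rfl, -⟩ := D.adj_inr_inl.1 h
    exact ⟨b, rfl⟩
  · obtain rfl := D.adj_inr_inr h
    rw [Subsingleton.elim s 0] at h
    exact absurd h (D.graph.loopless.irrefl _)

/-- Every inflation vertex lies in a triangle, so `c` and `d` are inserted vertices and their
neighbours are attachments. Adjacent attachments belong to the same vertex of `L`, so the edges of
`c` and `d` share both ends; without loops these ends are distinct. -/
lemma exists_link_of_hasParallelPaths (D : K1Insertion L fun _ => 3)
    (hL : ∀ e x, ¬ L.IsLink e x x) (h : D.graph.HasParallelPaths) :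
    ∃ e f x y, e ≠ f ∧ L.IsLink e x y ∧ L.IsLink f x y := by
  obtain ⟨c, d, p₁, p₂, q₁, q₂, hcd, hp, hc, hd, hc₁, hc₂, hd₁, hd₂, h₁, h₂⟩ := h
  have key (c : _) (hc : ∀ a b, D.graph.Adj c a → D.graph.Adj c b → ¬ D.graph.Adj a b) :
      ∃ e, c = .inr ⟨e, 0⟩ := by
    rcases c with ⟨x, i⟩ | ⟨e, s⟩
    · exfalso
      have hne (j k : Fin 3) (h : j ≠ k) : D.graph.Adj (.inl ⟨x, j⟩) (.inl ⟨x, k⟩) :=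
        D.adj_inl_inl.2 ⟨by simpa using h, rfl⟩
      have h3 : ∀ i : Fin 3, i ≠ i + 1 ∧ i ≠ i + 2 ∧ i + 1 ≠ i + 2 := by decide
      exact hc _ _ (hne _ _ (h3 i).1) (hne _ _ (h3 i).2.1) (hne _ _ (h3 i).2.2)
    · exact ⟨e, by rw [Subsingleton.elim s 0]⟩
  obtain ⟨e, rfl⟩ := key c hc
  obtain ⟨f, rfl⟩ := key d hd
  obtain ⟨b₁, rfl⟩ := D.exists_port_of_adj_insert hc₁
  obtain ⟨b₂, rfl⟩ := D.exists_port_of_adj_insert hc₂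
  obtain ⟨c₁, rfl⟩ := D.exists_port_of_adj_insert hd₁
  obtain ⟨c₂, rfl⟩ := D.exists_port_of_adj_insert hd₂
  have e₁ : D.ends e b₁ = D.ends f c₁ := (D.adj_inl_inl.1 h₁).2
  have e₂ : D.ends e b₂ = D.ends f c₂ := (D.adj_inl_inl.1 h₂).2
  have hb : b₂ = !b₁ := Bool.eq_not.2 fun h => hp (h ▸ rfl)
  subst hb
  have hlink := D.isLink_ends_not e b₁
  have hc : c₂ = !c₁ := Bool.eq_not.2 fun h => by
    subst h
    rw [e₁, e₂] at hlink
    exact hL _ _ hlink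
  subst hc
  refine ⟨e, f, _, _, fun h => hcd (by rw [Subtype.ext h]), hlink, ?_⟩
  rw [e₁, e₂]
  exact D.isLink_ends_not f c₁

/-- The witnesses are the vertices inserted in `e` and `f`. At each common end the two edges have
different attachments in the same triangle; the absence of loops keeps the inserted vertices out of
triangles. -/
lemma hasParallelPaths_of_link (D : K1Insertion L fun _ => 3) (hL : ∀ e x, ¬ L.IsLink e x x)
    {e f : E(L)} {x y : α} (hef : e ≠ f) (he : L.IsLink e x y) (hf : L.IsLink f x y) :
    D.graph.HasParallelPaths := by
  obtain ⟨b, rfl, rfl⟩ := D.exists_ends_of_isLink he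
  obtain ⟨c, hc, hc'⟩ := D.exists_ends_of_isLink hf
  have hadj (e : E(L)) (b : Bool) : D.graph.Adj (.inr ⟨e, 0⟩) (.inl (D.portVertex e b)) :=
    D.adj_inr_inl.2 ⟨b, rfl, Subsingleton.elim _ _⟩
  have htri (e : E(L)) (p q : _) (hp : D.graph.Adj (.inr ⟨e, 0⟩) p)
      (hq : D.graph.Adj (.inr ⟨e, 0⟩) q) : ¬ D.graph.Adj p q := by
    intro hpq
    obtain ⟨b, rfl⟩ := D.exists_port_of_adj_insert hp
    obtain ⟨c, rfl⟩ := D.exists_port_of_adj_insert hq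
    obtain ⟨h1, h2⟩ := D.adj_inl_inl.1 hpq
    obtain rfl : c = !b := Bool.eq_not.2 fun h => h1 (h ▸ rfl)
    have hlink := D.isLink_ends_not e b
    rw [show D.ends e b = D.ends e !b from h2] at hlink
    exact hL _ _ hlink
  have hne (b c : Bool) : D.portVertex e b ≠ D.portVertex f c := fun h =>
    hef (D.portVertex_inj h).1
  refine ⟨.inr ⟨e, 0⟩, .inr ⟨f, 0⟩, .inl (D.portVertex e b), .inl (D.portVertex e !b),
    .inl (D.portVertex f c), .inl (D.portVertex f !c), by simpa using hef, fun h => ?_, htri e,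
    htri f, hadj _ _, hadj _ _, hadj _ _, hadj _ _,
    D.adj_inl_inl.2 ⟨hne _ _, Subtype.ext hc.symm⟩, D.adj_inl_inl.2 ⟨hne _ _, Subtype.ext hc'.symm⟩⟩
  simpa using (D.portVertex_inj (Sum.inl_injective h)).2

lemma edgeSet_ncard (D : K1Insertion L fun _ => 3) [Finite V(L)] [Finite E(L)] :
    D.graph.edgeSet.ncard = Nat.card V(L) * 3 + Nat.card E(L) * 2 := by
  -- The edges of each triangle are listed cyclically, from `i` to `i + 1` in `Fin 3`, so that each
  -- occurs once; the others correspond to the edge-ends of `L`.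
  let g : (V(L) × Fin 3) ⊕ (E(L) × Bool) →
      Sym2 ((Σ _ : V(L), Fin 3) ⊕ (Σ _ : E(L), Fin 1)) :=
    Sum.elim (fun a => s(.inl ⟨a.1, a.2⟩, .inl ⟨a.1, a.2 + 1⟩))
      fun a => s(.inl (D.portVertex a.1 a.2), .inr ⟨a.1, 0⟩)
  have hg : Function.Injective g := by
    rintro (⟨x, i⟩ | ⟨e, b⟩) (⟨y, j⟩ | ⟨f, c⟩) h
    · simp only [g, Sum.elim_inl, Sym2.eq_iff, Sum.inl.injEq, Sigma.mk.injEq, heq_eq_eq] at h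
      obtain rfl : x = y := by tauto
      obtain rfl : i = j := by
        have h' : i = j ∧ i + 1 = j + 1 ∨ i = j + 1 ∧ i + 1 = j := by tauto
        clear h
        revert i j
        decide
      rfl
    · simp [g] at h
    · simp [g] at h
    · simp only [g, Sum.elim_inr, Sym2.eq_iff, Sum.inl.injEq, reduceCtorEq, false_and,
        or_false] at h
      obtain ⟨rfl, rfl⟩ := D.portVertex_inj h.1
      rfl
  have hr : D.graph.edgeSet = Set.range g := by
    ext z
    constructor
    · induction z using Sym2.ind with | _ u v
      intro h
      rw [SimpleGraph.mem_edgeSet] at h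
      rcases u with ⟨x, i⟩ | ⟨e, s⟩ <;> rcases v with ⟨y, j⟩ | ⟨f, t⟩
      · obtain ⟨h1, h2⟩ := D.adj_inl_inl.1 h
        obtain rfl : x = y := h2
        have hij : i ≠ j := by
          rintro rfl
          exact h1 rfl
        have h3 : ∀ i j : Fin 3, i ≠ j → j = i + 1 ∨ i = j + 1 := by decide
        obtain rfl | rfl := h3 i j hij
        · exact ⟨.inl (x, i), rfl⟩
        · exact ⟨.inl (x, j), Sym2.eq_swap⟩
      · obtain ⟨b, hb, -⟩ := D.adj_inl_inr.1 h
        rw [hb, Subsingleton.elim t 0]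
        exact ⟨.inr (f, b), rfl⟩
      · obtain ⟨b, hb, -⟩ := D.adj_inr_inl.1 h
        rw [hb, Subsingleton.elim s 0]
        exact ⟨.inr (e, b), Sym2.eq_swap⟩
      · obtain rfl := D.adj_inr_inr h
        rw [Subsingleton.elim s t] at h
        exact absurd h (D.graph.loopless.irrefl _)
    · rintro ⟨⟨x, i⟩ | ⟨e, b⟩, rfl⟩
      · refine D.adj_inl_inl.2 ⟨fun h => ?_, rfl⟩
        simp at h
      · exact D.adj_inl_inr.2 ⟨b, rfl, Subsingleton.elim _ _⟩
  rw [hr, ← Nat.card_coe_set_eq, Nat.card_range_of_injective hg, Nat.card_sum, Nat.card_prod,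
    Nat.card_prod]
  simp

/-- The numerical data of the graphs obtained from `K₃` and `K₁`. -/
lemma k1Insertion_three (D : K1Insertion L fun _ => 3) (hV : Nat.card V(L) = 4)
    (hE : E(L).ncard = 6) (hT : L.maxTrailLength = 5 ∧ L.IsAdmissible) :
    D.graph.IsCND ∧ Nat.card ((Σ _ : V(L), Fin 3) ⊕ (Σ _ : E(L), Fin 1)) = 18 ∧
      D.graph.edgeSet.ncard = 24 ∧ D.graph.detourOrder = 17 := by
  have hE' : Nat.card E(L) = 6 := hE
  have : Finite V(L) := (Nat.card_ne_zero.1 (by omega)).2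
  have : Finite E(L) := (Nat.card_ne_zero.1 (by omega)).2
  have hEf : E(L).Finite := Set.toFinite _
  have h1 : Nat.card (Σ _ : V(L), Fin 3) = 12 := by
    rw [Nat.card_congr (Equiv.sigmaEquivProd _ _), Nat.card_prod, hV, Nat.card_fin]
  have h2 : Nat.card (Σ _ : E(L), Fin 1) = 6 := by
    rw [Nat.card_congr (Equiv.sigmaEquivProd _ _), Nat.card_prod, hE', Nat.card_fin]
  have hm (e : E(L)) : Nat.card (Fin 1) = 1 := by simp
  obtain ⟨u⟩ : Nonempty (Σ _ : V(L), Fin 3) := (Nat.card_ne_zero.1 (by omega)).1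
  refine ⟨D.isCND hEf hT.2 hm, ?_, ?_, ?_⟩
  · rw [Nat.card_sum, h1, h2]
  · rw [edgeSet_ncard, hV, hE']
  · rw [D.detourOrder_eq hEf hT.2 hm (.inl u), h1, hT.1]

end InflationInsertion

/-! ### Explicit insertions for the two cubic multigraphs. -/

/-- The end `b` of an edge of `K₄`: the smaller vertex is the end `false`. -/
def k4End (e : Sym2 (Fin 4)) (b : Bool) : Fin 4 := if b then e.sup else e.inf

/-- The position of the edge `e` among the edges at its end `b`. -/
def k4Port (e : Sym2 (Fin 4)) (b : Bool) : ℕ :=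
  -- The three neighbours are numbered 0, 1, 2 in increasing order; those above the vertex itself
  -- move down by one to close its gap.
  if k4End e (!b) < k4End e b then k4End e !b else k4End e (!b) - 1

lemma k4Port_lt : ∀ e b, ¬ e.IsDiag → k4Port e b < 3 := by decide

lemma k4End_link : ∀ e : Sym2 (Fin 4), ¬ e.IsDiag →
    k4End e false ≠ k4End e true ∧ s(k4End e false, k4End e true) = e := by decide

lemma k4End_k4Port_inj : ∀ e : Sym2 (Fin 4), ¬ e.IsDiag → ∀ f : Sym2 (Fin 4), ¬ f.IsDiag →
    ∀ b c, k4End e b = k4End f c → k4Port e b = k4Port f c → e = f ∧ b = c := by decide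

lemma k4_not_isDiag (e : E(k4)) : ¬ e.1.IsDiag := by
  have h : e.1 ∈ ((Finset.univ.filter fun e : Sym2 (Fin 4) => ¬ e.IsDiag : Finset _) :
      Set (Sym2 (Fin 4))) := k4_edgeSet ▸ e.2
  simpa using h

/-- `K₄` with its vertices inflated and `K₁` inserted in its edges. -/
def k4Insertion (n : V(k4) → ℕ) (hn : ∀ x, 3 ≤ n x) : K1Insertion k4 n where
  ends e b := ⟨k4End e.1 b, trivial⟩
  isLink_ends e := k4_isLink.2 (k4End_link e.1 (k4_not_isDiag e))
  port e b := ⟨k4Port e.1 b, (k4Port_lt e.1 b (k4_not_isDiag e)).trans_le (hn _)⟩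
  port_injective := by
    rintro ⟨e, b⟩ ⟨f, c⟩ h
    have h1 := congrArg (fun a : Σ x : V(k4), Fin (n x) => a.1.1) h
    have h2 := congrArg (fun a : Σ x : V(k4), Fin (n x) => a.2.val) h
    obtain ⟨h3, rfl⟩ :=
      k4End_k4Port_inj e.1 (k4_not_isDiag e) f.1 (k4_not_isDiag f) b c h1 h2
    rw [Subtype.ext h3]
  anchor _ _ := 0
  anchor_spec _ := .inl (by simp)

/-- The end `b` of an edge of `C₂ × K₂`. -/
def c2BoxK2End (e : (Bool × Bool) ⊕ Bool) (b : Bool) : Bool × Bool :=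
  match e with
  | .inl (j, _) => (b, j)
  | .inr i => (i, b)

/-- The position of the edge `e` among the edges at its ends. -/
def c2BoxK2Port (e : (Bool × Bool) ⊕ Bool) : Fin 3 :=
  match e with
  | .inl (_, false) => 0
  | .inl (_, true) => 1
  | .inr _ => 2

lemma c2BoxK2End_c2BoxK2Port_inj : ∀ e f b c, c2BoxK2End e b = c2BoxK2End f c →
    c2BoxK2Port e = c2BoxK2Port f → e = f ∧ b = c := by decide

/-- `C₂ × K₂` with its vertices inflated with `K₃` and `K₁` inserted in its edges. -/
def c2BoxK2Insertion : K1Insertion Graph.c2BoxK2 (fun _ => 3) where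
  ends e b := ⟨c2BoxK2End e.1 b, trivial⟩
  isLink_ends := by
    rintro ⟨⟨j, k⟩ | i, h⟩
    · exact c2BoxK2_isLink_inl.2 rfl
    · exact c2BoxK2_isLink_inr.2 rfl
  port e _ := c2BoxK2Port e.1
  port_injective := by
    rintro ⟨e, b⟩ ⟨f, c⟩ h
    have h1 := congrArg (fun a : Σ _ : V(Graph.c2BoxK2), Fin 3 => a.1.1) h
    have h2 := congrArg (fun a : Σ _ : V(Graph.c2BoxK2), Fin 3 => a.2) h
    obtain ⟨h3, rfl⟩ := c2BoxK2End_c2BoxK2Port_inj e.1 f.1 b c h1 h2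
    rw [Subtype.ext h3]
  anchor _ _ := 0
  anchor_spec _ := .inl (by simp)

lemma k4_vertexSet : V(k4) = Set.univ := rfl

lemma c2BoxK2_vertexSet : V(Graph.c2BoxK2) = Set.univ := rfl

lemma k4Insertion_isCND (n : V(k4) → ℕ) (hn : ∀ x, 3 ≤ n x) : (k4Insertion n hn).graph.IsCND :=
  have : Finite V(k4) := Set.finite_univ.to_subtype
  (k4Insertion n hn).isCND (Set.toFinite _) k4_maxTrailLength_and_isAdmissible.2
    fun _ => Nat.card_eq_fintype_card

lemma card_k4Insertion (n : Fin 4 → ℕ) :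
    Nat.card ((Σ x : V(k4), Fin (n x)) ⊕ (Σ _ : E(k4), Fin 1)) = n 0 + n 1 + n 2 + n 3 + 6 := by
  have e₁ : (Σ x : V(k4), Fin (n x)) ≃ Σ x : Fin 4, Fin (n x) :=
    Equiv.sigmaCongrLeft (β := fun x => Fin (n x)) (Equiv.Set.univ (Fin 4))
  have h₂ : Nat.card (Σ _ : E(k4), Fin 1) = 6 := by
    rw [Nat.card_congr (Equiv.sigmaEquivProd _ _), Nat.card_prod, Nat.card_coe_set_eq,
      k4_edgeSet_ncard, Nat.card_fin]
  rw [Nat.card_congr (e₁.sumCongr (Equiv.refl _)), Nat.card_sum, h₂, Nat.card_sigma]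
  simp [Fin.sum_univ_four]

/-! ### Assembly of the three statements. -/

theorem mainTheorem6 :
    -- the construction gives CND graphs
    (∀ (α : Type*) (β : Type*) (L : Graph α β), V(L).Finite → E(L).Finite → L.IsAdmissible →
      ∀ (K : V(L) → Type*), (∀ x, Finite (K x)) → (∀ x : V(L), L.degree x ≤ Nat.card (K x)) →
      ∀ (m : ℕ) (W : E(L) → Type*) (M : ∀ e : E(L), SimpleGraph (W e)),
        (∀ e, Nat.card (W e) = m) → (∀ e, (M e).IsHCTV) →
      ∀ D : InflationInsertion L K M, D.graph.IsCND) ∧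
    -- CND graphs of every order at least 18, obtained from `K₄` by inflating with three copies of
    -- `K₃` and one complete graph of order `N - 15`, and inserting `K₁` in every edge
    k4.IsAdmissible ∧
    (∀ N : ℕ, 18 ≤ N → ∃ n : Fin 4 → ℕ, n 0 + 15 = N ∧ n 1 = 3 ∧ n 2 = 3 ∧ n 3 = 3 ∧
      (∀ x : V(k4), k4.degree x ≤ n x) ∧
      ∃ D : K1Insertion k4 (fun x => n x),
        Nat.card ((Σ x : V(k4), Fin (n x)) ⊕ (Σ _ : E(k4), Fin 1)) = N ∧ D.graph.IsCND) ∧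
    -- the two examples of order 18, obtained from `K₄` and from `C₂ × K₂`
    Graph.c2BoxK2.IsAdmissible ∧
    (∀ x : V(k4), k4.degree x = 3) ∧
    (∀ x : V(Graph.c2BoxK2), Graph.c2BoxK2.degree x = 3) ∧
    ∃ (D₁ : K1Insertion k4 (fun _ => 3)) (D₂ : K1Insertion Graph.c2BoxK2 (fun _ => 3)),
      (D₁.graph.IsCND ∧
        Nat.card ((Σ _ : V(k4), Fin 3) ⊕ (Σ _ : E(k4), Fin 1)) = 18 ∧
        D₁.graph.edgeSet.ncard = 24 ∧ D₁.graph.detourOrder = 17) ∧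
      (D₂.graph.IsCND ∧
        Nat.card ((Σ _ : V(Graph.c2BoxK2), Fin 3) ⊕ (Σ _ : E(Graph.c2BoxK2), Fin 1)) = 18 ∧
        D₂.graph.edgeSet.ncard = 24 ∧ D₂.graph.detourOrder = 17) ∧
      ¬ Nonempty (D₁.graph ≃g D₂.graph) := by
  refine ⟨?_, k4_maxTrailLength_and_isAdmissible.2, ?_, c2BoxK2_maxTrailLength_and_isAdmissible.2,
    fun x => k4_degree x, fun x => c2BoxK2_degree x, k4Insertion _ fun _ => le_rfl,
    c2BoxK2Insertion, ?_, ?_, ?_⟩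
  · intro α β L hV hE hL K hK _ m W M hm hM D
    have : Finite V(L) := hV.to_subtype
    have (e : E(L)) : Finite (W e) := (hM e).finite_and_nonempty.1
    have (e : E(L)) : Nonempty (W e) := (hM e).finite_and_nonempty.2
    exact D.isCND hE hL hm
  · intro N hN
    have hn (x : Fin 4) : 3 ≤ (![N - 15, 3, 3, 3] : Fin 4 → ℕ) x := by
      fin_cases x <;> simp; omega
    refine ⟨![N - 15, 3, 3, 3], by simp; omega, rfl, rfl, rfl,
      fun x => (k4_degree x).trans_le (hn x), k4Insertion _ fun x => hn x, ?_,
      k4Insertion_isCND _ _⟩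
    rw [card_k4Insertion]
    simp
    omega
  · refine InflationInsertion.k1Insertion_three _ ?_ k4_edgeSet_ncard
      k4_maxTrailLength_and_isAdmissible
    rw [k4_vertexSet, Nat.card_univ, Nat.card_eq_fintype_card]
    rfl
  · refine InflationInsertion.k1Insertion_three _ ?_ c2BoxK2_edgeSet_ncard
      c2BoxK2_maxTrailLength_and_isAdmissible
    rw [c2BoxK2_vertexSet, Nat.card_univ, Nat.card_eq_fintype_card]
    rfl
  · rintro ⟨φ⟩
    have hpar : c2BoxK2Insertion.graph.HasParallelPaths :=
      InflationInsertion.hasParallelPaths_of_link _ c2BoxK2_not_isLink_self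
        (e := ⟨.inl (false, false), by simp [c2BoxK2_edgeSet]⟩)
        (f := ⟨.inl (false, true), by simp [c2BoxK2_edgeSet]⟩) (by simp)
        (c2BoxK2_isLink_inl.2 rfl) (c2BoxK2_isLink_inl.2 rfl)
    obtain ⟨e, f, x, y, hef, he, hf⟩ := InflationInsertion.exists_link_of_hasParallelPaths _
      (fun e x h => (k4_isLink.1 h).1 rfl) (hpar.map φ.symm)
    -- An edge of `k4` is the pair of its ends, so parallel edges coincide.
    exact hef ((k4_isLink.1 he).2.symm.trans (k4_isLink.1 hf).2)
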